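/- Let $m\in(0,\infty)$ and let $S$ be either a finite set or $S=\mathbb Z^d$. Let $p(x,y)=p(y,x)\ge 0$ be an irreducible transition probability on $S$ with $\sum_y p(x,y)=1$ and $p(x,x)=0$; if $S=\mathbb Z^d$, assume moreover that $p$ is translation invariant and of finite range. Let SIP$(m)$ be the symmetric inclusion process, i.e. a Markov process $(\eta_t)_{t\ge0}$ of particle configurations $\eta\in\mathbb N^S$ with transition semigroup $(S_t)_{t\ge 0}$ whose generator acts on local functions by $$Lf(\eta)=\sum_{x,y\in S}p(x,y)\,2\eta_x(m+2\eta_y)\bigl(f(\eta^{x,y})-f(\eta)\bigr),$$ where $\eta^{x,y}$ arises from $\eta$ by moving one particle from $x$ to $y$. Precisely, for every local $f$ (a function of finitely many $\eta_x$, of at most polynomial growth in them), every starting configuration $\eta$ in the state space and every $t\ge 0$, $f(\eta_t)$ is integrable and $\mathbb E_\eta f(\eta_t)=f(\eta)+\int_0^t\mathbb E_\eta Lf(\eta_s)\,ds$. The state space is $\mathbb N^S$ if $S$ is finite, and the set of tempered configurations ($\eta(y)\le C(1+\|y\|)^k$ for all $y$, for some $C,k$) if $S=\mathbb Z^d$.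 For a profile $\bar\lambda:S\to[0,1)$ let $\nu_{\bar\lambda}=\bigotimes_{x\in S}\nu^m_{\bar\lambda(x)}$ with $$\nu^m_\lambda(n)=(1-\lambda)^{m/2}\,\frac{\lambda^n}{n!}\,\frac{\Gamma(\frac m2+n)}{\Gamma(\frac m2)},\qquad n\in\mathbb N .$$ If $S=\mathbb Z^d$, assume that $\nu_{\bar\lambda}$-almost every configuration is tempered, so that the process can be started from $\nu_{\bar\lambda}$. For finite configurations $\xi$ put $D(\xi,\eta)=\prod_x d(\xi_x,\eta_x)$, where $d(k,l)=\frac{l!}{(l-k)!}\frac{\Gamma(m/2)}{\Gamma(m/2+k)}$ if $k\le l$ and $d(k,l)=0$ otherwise, and for a probability measure $\mu$ on $\mathbb N^S$ put $K_\mu(x_1,\dots,x_n)=\int D\bigl(\sum_{i=1}^n\delta_{x_i},\eta\bigr)\,\mu(d\eta)$. Then for all $t\ge 0$, all $n$ and all $x_1,\dots,x_n\in S$ (not necessarily distinct), the moments below being finite, $$K_{\nu_{\bar\lambda}S_t}(x_1,\dots,x_n)\;\ge\;\prod_{i=1}^nK_{\nu_{\bar\lambda}S_t}(x_i).$$ In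 particular, when SIP$(m)$ is started from $\nu_{\bar\lambda}$, the variables $\{\eta_t(x),x\in S\}$ are positively correlated: for all $x,y\in S$, $$\int\mathbb E_\eta\bigl(\eta_t(x)\eta_t(y)\bigr)\,\nu_{\bar\lambda}(d\eta)\;\ge\;\int\mathbb E_\eta\bigl(\eta_t(x)\bigr)\,\nu_{\bar\lambda}(d\eta)\int\mathbb E_\eta\bigl(\eta_t(y)\bigr)\,\nu_{\bar\lambda}(d\eta).$$ -/

import Mathlib

open MeasureTheory ProbabilityTheory
open scoped NNReal ENNReal Nat

namespace SIP

noncomputable section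

/-- An irreducible symmetric random walk transition probability on `S` without holding. -/
structure IsWalkKernel {S : Type*} (p : S → S → ℝ) : Prop where
  nonneg : ∀ x y, 0 ≤ p x y
  symm : ∀ x y, p x y = p y x
  hasSum_one : ∀ x, HasSum (p x) 1
  diag : ∀ x, p x x = 0
  irreducible : ∀ x y, Relation.ReflTransGen (fun u v => 0 < p u v) x y

/-- Translation invariance on the lattice `ℤ^d`: `p x y` is a function of `y - x`. -/
def IsTranslationInvariant {d : ℕ} (p : (Fin d → ℤ) → (Fin d → ℤ) → ℝ) : Prop :=
  ∃ q : (Fin d → ℤ) → ℝ, ∀ x y, p x y = q (y - x)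

/-- Finite range on the lattice `ℤ^d`. -/
def HasFiniteRange {d : ℕ} (p : (Fin d → ℤ) → (Fin d → ℤ) → ℝ) : Prop :=
  ∃ R : ℝ, 0 < R ∧ ∀ x y, R < ‖x - y‖ → p x y = 0

/-- Tempered configurations on `ℤ^d`: at most polynomial growth of the occupation numbers. -/
def tempered (d : ℕ) : Set ((Fin d → ℤ) → ℕ) :=
  {η | ∃ (C : ℝ) (k : ℕ), ∀ y, (η y : ℝ) ≤ C * (1 + ‖y‖) ^ k}

open Classical in
/-- The configuration obtained from `η` by moving one particle from `x` to `y`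
(only used with `0 < η x` and `x ≠ y`). -/
def move {S : Type*} (η : S → ℕ) (x y : S) : S → ℕ :=
  Function.update (Function.update η x (η x - 1)) y (Function.update η x (η x - 1) y + 1)

/-- The generator of `SIP(m)`,
`L f(η) = ∑_{x,y} p(x,y) 2η_x (m + 2η_y) (f(η^{x,y}) - f(η))`. For a local function `f` and a
finite range kernel only finitely many terms are nonzero. -/
def generator {S : Type*} (m : ℝ) (p : S → S → ℝ) (f : (S → ℕ) → ℝ) (η : S → ℕ) : ℝ :=
  ∑' e : S × S, p e.1 e.2 * (2 * (η e.1 : ℝ)) * (m + 2 * (η e.2 : ℝ)) *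
    (f (move η e.1 e.2) - f η)

/-- Local functions (depending on finitely many sites) of at most polynomial growth in the
occupation numbers of these sites. -/
def IsLocalFunction {S : Type*} (f : (S → ℕ) → ℝ) : Prop :=
  ∃ Λ : Finset S, DependsOn f (Λ : Set S) ∧
    ∃ (C : ℝ) (k : ℕ), ∀ η, |f η| ≤ C * (1 + ∑ x ∈ Λ, (η x : ℝ)) ^ k

/-- `P` is the family of transition kernels of a symmetric inclusion process `SIP(m)` with state
space `X ⊆ ℕ^S`: a Markov semigroup on `X` whose generator is given by `generator m p` on local
functions, the latter in the form of Dynkin's formula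
`E_η f(η_t) = f(η) + ∫₀ᵗ E_η (L f)(η_s) ds`. -/
structure IsSIPSemigroup {S : Type*} (m : ℝ) (p : S → S → ℝ) (X : Set (S → ℕ))
    (P : ℝ≥0 → Kernel (S → ℕ) (S → ℕ)) : Prop where
  markov : ∀ t, IsMarkovKernel (P t)
  zero : ∀ η ∈ X, P 0 η = Measure.dirac η
  add : ∀ s t, ∀ η ∈ X, P (s + t) η = (P s η).bind (P t)
  preserves : ∀ t, ∀ η ∈ X, ∀ᵐ ζ ∂(P t η), ζ ∈ X
  integrable : ∀ f, IsLocalFunction f → ∀ t, ∀ η ∈ X, Integrable f (P t η)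
  integrable_generator : ∀ f, IsLocalFunction f → ∀ t : ℝ≥0, ∀ η ∈ X,
    IntervalIntegrable (fun s : ℝ => ∫ ζ, generator m p f ζ ∂(P s.toNNReal η)) volume 0 t
  dynkin : ∀ f, IsLocalFunction f → ∀ t : ℝ≥0, ∀ η ∈ X,
    ∫ ζ, f ζ ∂(P t η) =
      f η + ∫ s in (0 : ℝ)..t, ∫ ζ, generator m p f ζ ∂(P s.toNNReal η)

/-- The weights of the discrete gamma distribution,
`ν^m_l(n) = (1 / Z) (l^n / n!) Γ(m/2 + n) / Γ(m/2)` with `Z = (1 / (1 - l))^{m/2}`. -/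
def discreteGammaWeight (m l : ℝ) (n : ℕ) : ℝ :=
  1 / (1 / (1 - l)) ^ (m / 2) * (l ^ n / (n ! : ℝ)) *
    (Real.Gamma (m / 2 + n) / Real.Gamma (m / 2))

/-- The discrete gamma distribution on `ℕ`. -/
def discreteGamma (m l : ℝ) : Measure ℕ :=
  Measure.sum fun n => ENNReal.ofReal (discreteGammaWeight m l n) • Measure.dirac n

/-- The local stationary measure with profile `lam`: the product of the discrete gamma
distributions with site-dependent parameters. -/
def localStationary {S : Type*} (m : ℝ) (lam : S → ℝ) : Measure (S → ℕ) :=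
  Measure.infinitePi fun x => discreteGamma m (lam x)

/-- The single-site duality function
`d(k, l) = l! / (l - k)! * Γ(m/2) / Γ(m/2 + k)`, which is zero for `l < k`. -/
def singleDuality (m : ℝ) (k l : ℕ) : ℝ :=
  (l.descFactorial k : ℝ) * (Real.Gamma (m / 2) / Real.Gamma (m / 2 + k))

/-- The duality function `D(ξ, η) = ∏_x d(ξ_x, η_x)` for a finite configuration `ξ`
(sites without `ξ`-particles contribute a factor one). -/
def duality {S : Type*} (m : ℝ) (ξ η : S → ℕ) : ℝ :=
  ∏ᶠ x, singleDuality m (ξ x) (η x)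

open Classical in
/-- The configuration `∑ᵢ δ_{xᵢ}`. -/
def config {S : Type*} {n : ℕ} (x : Fin n → S) : S → ℕ :=
  fun z => ∑ i, if x i = z then 1 else 0

/-- The duality moment function `K_μ(x₁, …, xₙ) = ∫ D(∑ᵢ δ_{xᵢ}, η) μ(dη)`. -/
def dualityMoment {S : Type*} (m : ℝ) (μ : Measure (S → ℕ)) {n : ℕ} (x : Fin n → S) : ℝ :=
  ∫ η, duality m (config x) η ∂μ

theorem gamma_add_nat_div {a : ℝ} (ha : 0 < a) (n : ℕ) :
    Real.Gamma (a + n) / Real.Gamma a = (ascPochhammer ℝ n).eval a := by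
  induction n with
  | zero => simp [(Real.Gamma_pos_of_pos ha).ne']
  | succ n ih =>
    rw [ascPochhammer_succ_eval, ← ih, Nat.cast_succ, ← add_assoc,
      Real.Gamma_add_one (by positivity)]
    ring

theorem hasSum_discreteGammaWeight {m l : ℝ} (hm : 0 < m) (hl : l ∈ Set.Ico (0 : ℝ) 1) :
    HasSum (discreteGammaWeight m l) 1 := by
  have h := Real.one_div_one_sub_rpow_hasFPowerSeriesOnBall_zero (m / 2)
  have hmem : l ∈ Metric.eball (0 : ℝ) 1 := by
    rw [Metric.mem_eball, edist_dist, ENNReal.ofReal_lt_one]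
    simpa [abs_of_nonneg hl.1] using hl.2
  have h1 := h.hasSum hmem
  have hpos : (0 : ℝ) < 1 - l := by linarith [hl.2]
  have hp : (0 : ℝ) < (1 - l) ^ (m / 2) := Real.rpow_pos_of_pos hpos _
  have h2 := h1.mul_left ((1 - l) ^ (m / 2))
  have hval : (1 - l) ^ (m / 2) * (1 / (1 - (0 + l)) ^ (m / 2)) = 1 := by
    rw [zero_add]
    field_simp
  rw [hval] at h2
  have heq : discreteGammaWeight m l = fun i => (1 - l) ^ (m / 2) *
      (FormalMultilinearSeries.ofScalars ℝ
        (fun n : ℕ => Ring.choose (m / 2 + n - 1) n) i) fun _ => l := by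
    funext n
    have hch : Ring.choose (m / 2 + n - 1) n
        = (Real.Gamma (m / 2 + n) / Real.Gamma (m / 2)) / (n ! : ℝ) := by
      rw [gamma_add_nat_div (by positivity), ← Ring.multichoose_eq,
        eq_div_iff (by positivity)]
      have := Ring.factorial_nsmul_multichoose_eq_ascPochhammer (m / 2) n
      rw [nsmul_eq_mul, Polynomial.ascPochhammer_smeval_eq_eval] at this
      linarith
    simp only [FormalMultilinearSeries.ofScalars_apply_eq, hch, discreteGammaWeight, smul_eq_mul]
    rw [Real.div_rpow zero_le_one hpos.le, Real.one_rpow]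
    field_simp
  rw [heq]
  exact h2

theorem isProbabilityMeasure_discreteGamma {m l : ℝ} (hm : 0 < m)
    (hl : l ∈ Set.Ico (0 : ℝ) 1) : IsProbabilityMeasure (discreteGamma m l) := by
  have hs := hasSum_discreteGammaWeight hm hl
  have hnn : ∀ n, 0 ≤ discreteGammaWeight m l n := by
    intro n
    have h1 := hl.1
    have h2 : 0 < 1 - l := by linarith [hl.2]
    have h3 := Real.Gamma_pos_of_pos (show 0 < m / 2 + n by positivity)
    have h4 := Real.Gamma_pos_of_pos (show 0 < m / 2 by positivity)
    unfold discreteGammaWeight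
    positivity
  constructor
  simp only [discreteGamma, Measure.sum_apply _ MeasurableSet.univ, Measure.smul_apply,
    measure_univ, smul_eq_mul, mul_one]
  rw [← ENNReal.ofReal_tsum_of_nonneg hnn hs.summable, hs.tsum_eq, ENNReal.ofReal_one]

end

end SIP

/-! Put r = λ̄/(1 - λ̄). Self-duality says that L acting on D(ξ, η) in the variable η equals the
inclusion generator acting in ξ (`generator_duality`, which rests on the one-bond identity
`singleDuality_bond`). Dynkin's formula thus becomes a closed linear system for the expectations of
D, indexed by the positions of n labelled dual particles. After a shift by a = `dualRate m n` the
matrix A = `dualOp` of this system is nonnegative with finitely supported rows, and a nonnegative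
solution of v' = A v must be the exponential series of A (`FinitePositive.hasSum_of_integral_eq`).
Hence no dual process is constructed and no a priori growth bound on the expectations is needed.
Since D integrates to ∏ r(xᵢ) under the initial measure, the moment at time t is e^{-at} e^{tA}
applied to ∏ r(xᵢ) (`dualityMoment_bind`).

It remains to compare n inclusion particles with n independent walkers. The product of one-particle
means solves the equation without interaction. The attraction between the particles at xᵢ and xⱼ
contributes to it a nonnegative multiple of p(xᵢ, xⱼ) (ρ(xᵢ) - ρ(xⱼ))², where ρ is the one-particle
mean (`sum_interaction_nonneg`). So the product is a subsolution of the interacting equation with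
the same initial value, and it stays below the exponential series
(`FinitePositive.le_tsum_of_hasDerivAt`, `prod_walkMean_le`).

Convergence of the series and the comparison both need a weight W ≥ r with W(y) ≤ c W(x) along
allowed jumps. For finite S a constant serves. On the lattice a polynomial serves: temperedness of
almost every initial configuration forces polynomial growth of r, by a second moment estimate
(`exists_profile_le_of_ae_tempered`). -/

namespace SIP

/-! ### Nonnegative row-finite operators and their exponential series. -/

section PositiveOperators

variable {E : Type*}

/-- `A` acts on functions by a nonnegative matrix whose rows are finitely supported. -/
def FinitePositive (A : (E → ℝ) → E → ℝ) : Prop :=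
  ∀ x, ∃ c : E →₀ ℝ, (∀ y, 0 ≤ c y) ∧ ∀ f, A f x = c.sum fun y r => r * f y

theorem finitePositive_single {g : E → E} {r : E → ℝ} (hr : ∀ x, 0 ≤ r x) :
    FinitePositive fun f x => r x * f (g x) := by
  intro x
  refine ⟨Finsupp.single (g x) (r x), fun y => ?_, fun f => by simp⟩
  classical
  rw [Finsupp.single_apply]
  split_ifs <;> simp [hr]

theorem FinitePositive.add {A B : (E → ℝ) → E → ℝ} (hA : FinitePositive A)
    (hB : FinitePositive B) : FinitePositive fun f x => A f x + B f x := by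
  intro x
  obtain ⟨a, ha, hA⟩ := hA x
  obtain ⟨b, hb, hB⟩ := hB x
  refine ⟨a + b, fun y => add_nonneg (ha y) (hb y), fun f => ?_⟩
  simp only [hA, hB]
  rw [Finsupp.sum_add_index'] <;> intros <;> ring

theorem finitePositive_sum {ι : Type*} (s : E → Finset ι) {A : ι → (E → ℝ) → E → ℝ}
    (hA : ∀ i, FinitePositive (A i)) : FinitePositive fun f x => ∑ i ∈ s x, A i f x := by
  intro x
  choose c hc hA using fun i => hA i x
  refine ⟨∑ i ∈ s x, c i, fun y => ?_, fun f => ?_⟩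
  · rw [Finsupp.finsetSum_apply]
    exact Finset.sum_nonneg fun i _ => hc i y
  · rw [← Finsupp.sum_finsetSum_index (by simp) (by intros; ring)]
    exact Finset.sum_congr rfl fun i _ => hA i f

variable {A : (E → ℝ) → E → ℝ}

theorem FinitePositive.mono (hA : FinitePositive A) {f g : E → ℝ} (h : ∀ x, f x ≤ g x) (x : E) :
    A f x ≤ A g x := by
  obtain ⟨c, hc, hA⟩ := hA x
  rw [hA, hA]
  exact Finset.sum_le_sum fun y _ => mul_le_mul_of_nonneg_left (h y) (hc y)

theorem FinitePositive.map_zero (hA : FinitePositive A) (x : E) : A (fun _ => 0) x = 0 := by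
  obtain ⟨c, hc, hA⟩ := hA x
  simp [hA, Finsupp.sum]

theorem FinitePositive.nonneg (hA : FinitePositive A) {f : E → ℝ} (h : ∀ x, 0 ≤ f x) (x : E) :
    0 ≤ A f x :=
  (hA.map_zero x).symm.le.trans (hA.mono h x)

theorem FinitePositive.map_const_mul (hA : FinitePositive A) (r : ℝ) (f : E → ℝ) (x : E) :
    A (fun y => r * f y) x = r * A f x := by
  obtain ⟨c, hc, hA⟩ := hA x
  simp only [hA, Finsupp.sum, Finset.mul_sum]
  exact Finset.sum_congr rfl fun y _ => by ring

theorem FinitePositive.map_add (hA : FinitePositive A) (f g : E → ℝ) (x : E) :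
    A (fun y => f y + g y) x = A f x + A g x := by
  obtain ⟨c, hc, hA⟩ := hA x
  simp only [hA, Finsupp.sum, ← Finset.sum_add_distrib]
  exact Finset.sum_congr rfl fun y _ => by ring

theorem FinitePositive.map_sub (hA : FinitePositive A) (f g : E → ℝ) (x : E) :
    A (fun y => f y - g y) x = A f x - A g x := by
  obtain ⟨c, hc, hA⟩ := hA x
  simp only [hA, Finsupp.sum, ← Finset.sum_sub_distrib]
  exact Finset.sum_congr rfl fun y _ => by ring

theorem FinitePositive.map_sum (hA : FinitePositive A) {ι : Type*} (s : Finset ι)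
    (f : ι → E → ℝ) (x : E) : A (fun y => ∑ i ∈ s, f i y) x = ∑ i ∈ s, A (f i) x := by
  obtain ⟨c, hc, hA⟩ := hA x
  simp only [hA, Finsupp.sum, Finset.mul_sum]
  exact Finset.sum_comm

theorem FinitePositive.continuous (hA : FinitePositive A) {T : Type*} [TopologicalSpace T]
    {v : T → E → ℝ} (hv : ∀ x, Continuous fun t => v t x) (x : E) :
    Continuous fun t => A (v t) x := by
  obtain ⟨c, hc, hA⟩ := hA x
  simp only [hA, Finsupp.sum]
  exact continuous_finsetSum _ fun y _ => continuous_const.mul (hv y)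

theorem FinitePositive.integrable (hA : FinitePositive A) {T : Type*} [MeasurableSpace T]
    {μ : Measure T} {v : T → E → ℝ} (hv : ∀ x, Integrable (fun t => v t x) μ) (x : E) :
    Integrable (fun t => A (v t) x) μ := by
  obtain ⟨c, hc, hA⟩ := hA x
  simp only [hA, Finsupp.sum]
  exact integrable_finsetSum _ fun y _ => (hv y).const_mul _

theorem FinitePositive.integral (hA : FinitePositive A) {T : Type*} [MeasurableSpace T]
    {μ : Measure T} {v : T → E → ℝ} (hv : ∀ x, Integrable (fun t => v t x) μ) (x : E) :
    ∫ t, A (v t) x ∂μ = A (fun y => ∫ t, v t y ∂μ) x := by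
  obtain ⟨c, hc, hA⟩ := hA x
  simp only [hA, Finsupp.sum]
  rw [integral_finsetSum _ fun y _ => (hv y).const_mul _]
  exact Finset.sum_congr rfl fun y _ => integral_const_mul _ _

theorem FinitePositive.iterate_nonneg (hA : FinitePositive A) {f : E → ℝ} (h : ∀ x, 0 ≤ f x)
    (k : ℕ) (x : E) : 0 ≤ A^[k] f x := by
  induction k generalizing x with
  | zero => exact h x
  | succ k ih => rw [Function.iterate_succ_apply']; exact hA.nonneg ih x

theorem FinitePositive.integrable_iterate (hA : FinitePositive A) {T : Type*} [MeasurableSpace T]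
    {μ : Measure T} {v : T → E → ℝ} (hv : ∀ x, Integrable (fun t => v t x) μ) (k : ℕ) (x : E) :
    Integrable (fun t => A^[k] (v t) x) μ := by
  induction k generalizing x with
  | zero => exact hv x
  | succ k ih => simp only [Function.iterate_succ_apply']; exact hA.integrable ih x

theorem FinitePositive.integral_iterate (hA : FinitePositive A) {T : Type*} [MeasurableSpace T]
    {μ : Measure T} {v : T → E → ℝ} (hv : ∀ x, Integrable (fun t => v t x) μ) (k : ℕ) (x : E) :
    ∫ t, A^[k] (v t) x ∂μ = A^[k] (fun y => ∫ t, v t y ∂μ) x := by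
  induction k generalizing x with
  | zero => rfl
  | succ k ih =>
    simp only [Function.iterate_succ_apply']
    rw [hA.integral (hA.integrable_iterate hv k)]
    exact congrArg (A · x) (funext ih)

/-- W acts as a Lyapunov weight: one application of A costs a factor c, which makes the exponential
series converge although A need not be bounded. -/
theorem FinitePositive.iterate_le (hA : FinitePositive A) {f W : E → ℝ} {c : ℝ} (hc : 0 ≤ c)
    (hW : ∀ x, A W x ≤ c * W x) (h : ∀ x, f x ≤ W x) (k : ℕ) (x : E) :
    A^[k] f x ≤ c ^ k * W x := by
  induction k generalizing x with
  | zero => simpa using h x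
  | succ k ih =>
    rw [Function.iterate_succ_apply']
    calc A (A^[k] f) x ≤ A (fun y => c ^ k * W y) x := hA.mono ih x
      _ = c ^ k * A W x := hA.map_const_mul _ _ _
      _ ≤ c ^ k * (c * W x) := mul_le_mul_of_nonneg_left (hW x) (by positivity)
      _ = c ^ (k + 1) * W x := by ring

theorem integral_pow_div_factorial (j : ℕ) (t b : ℝ) :
    ∫ s in (0 : ℝ)..t, s ^ j / (j ! : ℝ) * b = t ^ (j + 1) / ((j + 1)! : ℝ) * b := by
  rw [intervalIntegral.integral_mul_const, intervalIntegral.integral_div, integral_pow,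
    Nat.factorial_succ]
  push_cast
  field_simp
  simp

theorem hasDerivAt_pow_succ_div_factorial (j : ℕ) (t : ℝ) :
    HasDerivAt (fun s : ℝ => s ^ (j + 1) / ((j + 1)! : ℝ)) (t ^ j / (j ! : ℝ)) t := by
  convert! (hasDerivAt_pow (j + 1) t).div_const ((j + 1)! : ℝ) using 1
  rw [Nat.factorial_succ]
  push_cast
  field_simp

/-- Bernstein's theorem on absolutely monotone functions for the equation `dv/dt = A v`:
a nonnegative solution is given by the exponential series. -/
theorem FinitePositive.hasSum_of_integral_eq (hA : FinitePositive A) {v : ℝ → E → ℝ}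
    (hv0 : ∀ t x, 0 ≤ v t x) (hcont : ∀ x, Continuous fun t => v t x)
    (heq : ∀ t, 0 ≤ t → ∀ x, v t x = v 0 x + ∫ s in (0 : ℝ)..t, A (v s) x)
    {t : ℝ} (ht : 0 ≤ t) (x : E) :
    HasSum (fun k => t ^ k / (k ! : ℝ) * A^[k] (v 0) x) (v t x) := by
  -- The Taylor remainder of order k at time 0. Each remainder is the integral of A applied to the
  -- previous one, so all of them are nonnegative for t ≥ 0.
  set R : ℕ → ℝ → E → ℝ := fun k t x =>
    v t x - ∑ j ∈ Finset.range k, t ^ j / (j ! : ℝ) * A^[j] (v 0) x with hR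
  have hRc : ∀ k x, Continuous fun t => R k t x := by
    intro k x
    simp only [hR]
    exact (hcont x).sub (by fun_prop)
  have hstep : ∀ k t, 0 ≤ t → ∀ x, R (k + 1) t x = ∫ s in (0 : ℝ)..t, A (R k s) x := by
    intro k t ht x
    have h1 : ∀ s, A (R k s) x = A (v s) x -
        ∑ j ∈ Finset.range k, s ^ j / (j ! : ℝ) * A^[j + 1] (v 0) x := by
      intro s
      simp only [hR]
      rw [hA.map_sub, hA.map_sum]
      congr 1
      refine Finset.sum_congr rfl fun j _ => ?_
      rw [hA.map_const_mul, Function.iterate_succ_apply']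
    simp only [h1]
    rw [intervalIntegral.integral_sub ((hA.continuous hcont x).intervalIntegrable _ _)
      (Continuous.intervalIntegrable (by fun_prop) _ _),
      intervalIntegral.integral_finsetSum
        (fun j _ => Continuous.intervalIntegrable (by fun_prop) _ _)]
    simp only [integral_pow_div_factorial]
    simp only [hR]
    rw [heq t ht x, Finset.sum_range_succ']
    simp
    ring
  have hnn : ∀ k t, 0 ≤ t → ∀ x, 0 ≤ R k t x := by
    intro k
    induction k with
    | zero => intro t _ x; simpa [hR] using hv0 t x
    | succ k ih =>
      intro t ht x
      rw [hstep k t ht x]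
      refine intervalIntegral.integral_nonneg ht fun s hs => ?_
      exact hA.nonneg (ih s hs.1) x
  -- Replaces the monotonicity of R k t / t^k in t. For k = 0 it says that v increases; the
  -- induction rescales time by 2 in the integral recursion.
  have hscale : ∀ k r, 0 ≤ r → ∀ x, 2 ^ k * R k r x ≤ R k (2 * r) x := by
    intro k
    induction k with
    | zero =>
      intro r hr x
      simp only [hR, pow_zero, one_mul, Finset.range_zero, Finset.sum_empty, sub_zero]
      have hInt := fun a b => (hA.continuous hcont x).intervalIntegrable a b (μ := volume)
      rw [heq r hr x, heq (2 * r) (by positivity) x,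
        ← intervalIntegral.integral_add_adjacent_intervals (hInt 0 r) (hInt r (2 * r))]
      have : 0 ≤ ∫ s in r..2 * r, A (v s) x :=
        intervalIntegral.integral_nonneg (by linarith) fun s _ => hA.nonneg (hv0 s) x
      linarith
    | succ k ih =>
      intro r hr x
      rw [hstep k r hr x, hstep k (2 * r) (by positivity) x]
      have h2 : ∫ s in (0 : ℝ)..2 * r, A (R k s) x = 2 * ∫ s in (0 : ℝ)..r, A (R k (2 * s)) x := by
        rw [intervalIntegral.integral_comp_mul_left (fun s => A (R k s) x) two_ne_zero]
        simp
      rw [h2, pow_succ', mul_assoc, ← intervalIntegral.integral_const_mul]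
      refine mul_le_mul_of_nonneg_left ?_ (by norm_num)
      refine intervalIntegral.integral_mono_on hr ?_ ?_ fun s hs => ?_
      · exact ((hA.continuous (hRc k) x).const_mul _).intervalIntegrable _ _
      · exact ((hA.continuous (hRc k) x).comp (continuous_const.mul continuous_id)).intervalIntegrable _ _
      · rw [← hA.map_const_mul]
        exact hA.mono (ih s hs.1) x
  -- The remainder at 2t is at most v (2t), whence a geometric bound at t. Existence of the solution
  -- beyond t replaces any growth condition in x.
  have hle : ∀ k, R k t x ≤ (1 / 2) ^ k * v (2 * t) x := by
    intro k
    have h1 := hscale k t ht x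
    have h2 : R k (2 * t) x ≤ v (2 * t) x := by
      simp only [hR, sub_le_self_iff]
      exact Finset.sum_nonneg fun j _ => mul_nonneg (by positivity) (hA.iterate_nonneg (hv0 0) j x)
    have h3 : (1 / 2 : ℝ) ^ k * 2 ^ k = 1 := by rw [← mul_pow]; norm_num
    calc R k t x = (1 / 2) ^ k * (2 ^ k * R k t x) := by rw [← mul_assoc, h3, one_mul]
      _ ≤ (1 / 2) ^ k * v (2 * t) x := by gcongr; exact h1.trans h2
  have hlim : Filter.Tendsto (fun k => R k t x) Filter.atTop (nhds 0) := by
    refine squeeze_zero (fun k => hnn k t ht x) hle ?_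
    have := (tendsto_pow_atTop_nhds_zero_of_lt_one (r := (1 / 2 : ℝ)) (by norm_num)
      (by norm_num)).mul_const (v (2 * t) x)
    simpa using this
  refine (hasSum_iff_tendsto_nat_of_nonneg (fun k => mul_nonneg (by positivity)
    (hA.iterate_nonneg (hv0 0) k x)) _).2 ?_
  have := (tendsto_const_nhds (x := v t x)).sub hlim
  simpa [hR] using this

theorem summable_expSeries {b : ℕ → ℝ} {M c : ℝ} (hb : ∀ k, |b k| ≤ M * c ^ k) (t : ℝ) :
    Summable fun k => t ^ k / (k ! : ℝ) * b k := by
  refine Summable.of_norm_bounded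
    (g := fun k => M * ((|t| * c) ^ k / (k ! : ℝ))) ?_ fun k => ?_
  · exact (Real.summable_pow_div_factorial _).mul_left _
  · rw [norm_mul, norm_div, norm_pow, Real.norm_eq_abs, Real.norm_eq_abs, Real.norm_eq_abs,
      Nat.abs_cast]
    calc |t| ^ k / (k ! : ℝ) * |b k| ≤ |t| ^ k / (k ! : ℝ) * (M * c ^ k) := by gcongr; exact hb k
      _ = _ := by rw [mul_pow]; ring

theorem hasDerivAt_expSeries {b : ℕ → ℝ} {M c : ℝ} (hb : ∀ k, |b k| ≤ M * c ^ k) (t : ℝ) :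
    HasDerivAt (fun s => ∑' k, s ^ k / (k ! : ℝ) * b k) (∑' k, t ^ k / (k ! : ℝ) * b (k + 1)) t := by
  have hsplit : (fun s : ℝ => ∑' k, s ^ k / (k ! : ℝ) * b k) =
      fun s => b 0 + ∑' k, s ^ (k + 1) / ((k + 1)! : ℝ) * b (k + 1) := by
    funext s
    rw [(summable_expSeries hb s).tsum_eq_zero_add]
    simp
  rw [hsplit]
  refine HasDerivAt.const_add _ ?_
  set r : ℝ := |t| + 1
  refine hasDerivAt_tsum_of_isPreconnected (t := Metric.ball 0 r) (y₀ := 0)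
    (u := fun k => (M * c) * ((r * c) ^ k / (k ! : ℝ)))
    ((Real.summable_pow_div_factorial _).mul_left _) Metric.isOpen_ball
    (convex_ball _ _).isPreconnected
    (fun k s _ => (hasDerivAt_pow_succ_div_factorial k s).mul_const _) (fun k s hs => ?_)
    (Metric.mem_ball_self (by positivity)) (by simp) ?_
  · rw [norm_mul, norm_div, norm_pow, Real.norm_eq_abs, Real.norm_eq_abs, Real.norm_eq_abs,
      Nat.abs_cast]
    have hs' : |s| ≤ r := by
      have := Metric.mem_ball.1 hs
      rw [dist_zero_right, Real.norm_eq_abs] at this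
      exact this.le
    calc |s| ^ k / (k ! : ℝ) * |b (k + 1)|
        ≤ r ^ k / (k ! : ℝ) * (M * c ^ (k + 1)) := by
          gcongr
          exact hb _
      _ = _ := by rw [mul_pow, pow_succ]; ring
  · rw [Metric.mem_ball, dist_zero_right, Real.norm_eq_abs]
    simp [r]

/-- A subsolution of `dv/dt = A v` of controlled growth is bounded by the exponential series. -/
theorem FinitePositive.le_tsum_of_hasDerivAt (hA : FinitePositive A) {g g' : ℝ → E → ℝ}
    {W : E → ℝ} {c C T : ℝ} (hc : 0 ≤ c) (hC : 0 ≤ C) (hW : ∀ x, A W x ≤ c * W x)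
    (hg : ∀ t x, HasDerivAt (fun s => g s x) (g' t x) t)
    (hg' : ∀ t ∈ Set.Icc 0 T, ∀ x, g' t x ≤ A (g t) x)
    (hgW : ∀ t ∈ Set.Icc 0 T, ∀ x, g t x ≤ C * W x)
    (hg0 : ∀ x, 0 ≤ g 0 x) {t : ℝ} (ht : t ∈ Set.Icc 0 T) (x : E) :
    g t x ≤ ∑' k, t ^ k / (k ! : ℝ) * A^[k] (g 0) x := by
  -- Picard iteration of the differential inequality, started from the crude bound C W. The last
  -- term tends to 0 as k grows because of the factorial.
  have key : ∀ k, ∀ t ∈ Set.Icc 0 T, ∀ x, g t x ≤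
      ∑ j ∈ Finset.range k, t ^ j / (j ! : ℝ) * A^[j] (g 0) x +
        t ^ k / (k ! : ℝ) * (C * c ^ k * W x) := by
    intro k
    induction k with
    | zero => intro t ht x; simpa using hgW t ht x
    | succ k ih =>
      intro t ht x
      set F : ℝ → ℝ := fun s => ∑ j ∈ Finset.range (k + 1), s ^ j / (j ! : ℝ) * A^[j] (g 0) x +
        s ^ (k + 1) / ((k + 1)! : ℝ) * (C * c ^ (k + 1) * W x) with hF
      have hF' : ∀ s, HasDerivAt F (∑ j ∈ Finset.range k, s ^ j / (j ! : ℝ) * A^[j + 1] (g 0) x +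
          s ^ k / (k ! : ℝ) * (C * c ^ (k + 1) * W x)) s := by
        intro s
        simp only [hF, Finset.sum_range_succ', pow_zero]
        refine HasDerivAt.add (HasDerivAt.add_const _ ?_) ?_
        · exact HasDerivAt.fun_sum fun j _ =>
            (hasDerivAt_pow_succ_div_factorial j s).mul_const _
        · exact (hasDerivAt_pow_succ_div_factorial k s).mul_const _
      -- The upper bound F grows at least as fast as g: its derivative dominates A applied to the
      -- bound of order k, hence A g, hence g'.
      have hmono : MonotoneOn (fun s => F s - g s x) (Set.Icc 0 T) := by
        have hd : ∀ s, HasDerivAt (fun s => F s - g s x) _ s := fun s => (hF' s).sub (hg s x)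
        refine monotoneOn_of_deriv_nonneg (convex_Icc 0 T)
          (fun s _ => (hd s).continuousAt.continuousWithinAt)
          (fun s _ => (hd s).differentiableAt.differentiableWithinAt) fun s hs => ?_
        rw [interior_Icc] at hs
        have hs' : s ∈ Set.Icc 0 T := ⟨hs.1.le, hs.2.le⟩
        have hs0 : 0 ≤ s := hs.1.le
        rw [(hd s).deriv, sub_nonneg]
        refine (hg' s hs' x).trans ((hA.mono (ih s hs') x).trans ?_)
        rw [hA.map_add, hA.map_sum, hA.map_const_mul, hA.map_const_mul]
        refine add_le_add (Finset.sum_le_sum fun j _ => ?_) ?_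
        · rw [hA.map_const_mul, Function.iterate_succ_apply']
        · have h1 : C * c ^ k * A W x ≤ C * c ^ (k + 1) * W x := by
            calc C * c ^ k * A W x ≤ C * c ^ k * (c * W x) :=
                  mul_le_mul_of_nonneg_left (hW x) (by positivity)
              _ = _ := by ring
          gcongr
      have h0 : (0 : ℝ) ∈ Set.Icc 0 T := ⟨le_rfl, ht.1.trans ht.2⟩
      have := hmono h0 ht ht.1
      simp only [hF, Finset.sum_range_succ'] at this
      simp at this
      rw [Finset.sum_range_succ']
      simp
      linarith
  have hT : 0 ≤ T := ht.1.trans ht.2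
  have hb : ∀ k, |A^[k] (g 0) x| ≤ C * W x * c ^ k := by
    intro k
    rw [abs_of_nonneg (hA.iterate_nonneg hg0 k x)]
    have := hA.iterate_le (f := g 0) (W := fun x => C * W x) hc
      (fun x => by
        rw [hA.map_const_mul]
        nlinarith [mul_le_mul_of_nonneg_left (hW x) hC]) (hgW 0 ⟨le_rfl, hT⟩) k x
    linarith
  have hlim1 := (summable_expSeries hb t).hasSum.tendsto_sum_nat
  have hlim2 : Filter.Tendsto (fun k => t ^ k / (k ! : ℝ) * (C * c ^ k * W x)) Filter.atTop
      (nhds 0) := by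
    have h := (FloorSemiring.tendsto_pow_div_factorial_atTop (t * c)).const_mul (C * W x)
    rw [mul_zero] at h
    refine h.congr fun k => ?_
    rw [mul_pow]; ring
  refine ge_of_tendsto' (x := Filter.atTop) (by simpa using hlim1.add hlim2) fun k => key k t ht x

end PositiveOperators

/-! ### Duality functions and the one-bond identity. -/

section Duality

variable {S : Type*} {m : ℝ}

theorem singleDuality_zero (hm : 0 < m) (l : ℕ) : singleDuality m 0 l = 1 := by
  have := (Real.Gamma_pos_of_pos (show 0 < m / 2 by positivity)).ne'
  simp [singleDuality, this]

theorem singleDuality_nonneg (hm : 0 < m) (k l : ℕ) : 0 ≤ singleDuality m k l := by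
  have h1 := Real.Gamma_pos_of_pos (show 0 < m / 2 by positivity)
  have h2 := Real.Gamma_pos_of_pos (show 0 < m / 2 + k by positivity)
  unfold singleDuality
  positivity

theorem Gamma_div_succ (hm : 0 < m) (k : ℕ) :
    (m / 2 + k) * (Real.Gamma (m / 2) / Real.Gamma (m / 2 + (k + 1 : ℕ))) =
      Real.Gamma (m / 2) / Real.Gamma (m / 2 + k) := by
  have h2 := Real.Gamma_pos_of_pos (show 0 < m / 2 + k by positivity)
  have h3 : 0 < m / 2 + k := by positivity
  rw [Nat.cast_succ, ← add_assoc, Real.Gamma_add_one h3.ne']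
  field_simp

theorem cast_descFactorial_succ (l k : ℕ) :
    (l.descFactorial (k + 1) : ℝ) = ((l : ℝ) - k) * (l.descFactorial k : ℝ) := by
  rw [Nat.descFactorial_succ]
  rcases le_or_gt k l with h | h
  · push_cast [Nat.cast_sub h]; ring
  · rw [Nat.descFactorial_of_lt h]; simp

theorem singleDuality_succ_left (hm : 0 < m) (k l : ℕ) :
    (m / 2 + k) * singleDuality m (k + 1) l = (l - k) * singleDuality m k l := by
  unfold singleDuality
  rw [← Gamma_div_succ hm k, cast_descFactorial_succ]
  ring

theorem singleDuality_succ_succ (hm : 0 < m) (k l : ℕ) :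
    (m / 2 + k) * singleDuality m (k + 1) (l + 1) = (l + 1) * singleDuality m k l := by
  unfold singleDuality
  rw [← Gamma_div_succ hm k, Nat.succ_descFactorial_succ]
  push_cast
  ring

theorem singleDuality_succ_right (m : ℝ) (k l : ℕ) :
    ((l : ℝ) - k + 1) * singleDuality m k (l + 1) = (l + 1) * singleDuality m k l := by
  have h : ((l : ℝ) - k + 1) * ((l + 1).descFactorial k : ℝ) = (l + 1) * (l.descFactorial k : ℝ) := by
    rcases le_or_gt k (l + 1) with h | h
    · have := Nat.succ_descFactorial l k
      have h2 : ((l + 1 - k : ℕ) : ℝ) = (l : ℝ) - k + 1 := by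
        rw [Nat.cast_sub h]; push_cast; ring
      rw [← h2]
      exact_mod_cast this
    · rw [Nat.descFactorial_of_lt h, Nat.descFactorial_of_lt (by omega)]
      simp
  unfold singleDuality
  rw [← mul_assoc, ← mul_assoc, h]

/-- The truncated subtraction at l = 0 is harmless: the left side has the factor l, and on the right
either k = 0 or the duality function vanishes. -/
theorem singleDuality_pred_right (m : ℝ) (k l : ℕ) :
    (l : ℝ) * singleDuality m k (l - 1) = (l - k) * singleDuality m k l := by
  rcases l with _ | l
  · rcases k with _ | k
    · simp
    · simp [singleDuality]
  · have := singleDuality_succ_right m k l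
    push_cast
    linarith

/-- Discrete differentiation in l lowers the degree k of the falling factorial. This trades removal
of a dual particle for addition of an original one. -/
theorem singleDuality_pred_left (hm : 0 < m) (k l : ℕ) :
    (k : ℝ) * singleDuality m (k - 1) l =
      (m / 2 + k - 1) * (singleDuality m k (l + 1) - singleDuality m k l) := by
  rcases k with _ | k
  · simp [singleDuality_zero hm]
  · have h1 := singleDuality_succ_succ hm k l
    have h2 := singleDuality_succ_left hm k l
    push_cast
    linarith

/-- Self-duality of the inclusion process on a single bond. -/
theorem singleDuality_bond (hm : 0 < m) (a b k l : ℕ) :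
    (2 * (k : ℝ)) * (m + 2 * l) * (singleDuality m a (k - 1) * singleDuality m b (l + 1) -
        singleDuality m a k * singleDuality m b l) +
      (2 * (l : ℝ)) * (m + 2 * k) * (singleDuality m a (k + 1) * singleDuality m b (l - 1) -
        singleDuality m a k * singleDuality m b l) =
    (2 * (a : ℝ)) * (m + 2 * b) * (singleDuality m (a - 1) k * singleDuality m (b + 1) l -
        singleDuality m a k * singleDuality m b l) +
      (2 * (b : ℝ)) * (m + 2 * a) * (singleDuality m (a + 1) k * singleDuality m (b - 1) l -
        singleDuality m a k * singleDuality m b l) := by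
  have hX := singleDuality_pred_right m a k
  have hX' := singleDuality_pred_right m b l
  have hZ := singleDuality_succ_left hm a k
  have hZ' := singleDuality_succ_left hm b l
  have hU := singleDuality_pred_left hm a k
  have hU' := singleDuality_pred_left hm b l
  have hY := singleDuality_succ_right m a k
  have hY' := singleDuality_succ_right m b l
  generalize singleDuality m a (k - 1) = X at *
  generalize singleDuality m b (l - 1) = X' at *
  generalize singleDuality m (a + 1) k = Z at *
  generalize singleDuality m (b + 1) l = Z' at *
  generalize singleDuality m (a - 1) k = U at *
  generalize singleDuality m (b - 1) l = U' at *
  generalize singleDuality m a (k + 1) = Y at *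
  generalize singleDuality m b (l + 1) = Y' at *
  generalize singleDuality m a k = A at *
  generalize singleDuality m b l = B at *
  -- With the ten values treated as unknowns, `hX` and `hX'` eliminate the lowered arguments on the
  -- left, `hU`, `hU'`, `hZ` and `hZ'` all shifts in the dual variable on the right, and `hY` and
  -- `hY'` match what is left.
  linear_combination 2 * (m + 2 * l) * Y' * hX + 2 * (m + 2 * k) * Y * hX'
    - 2 * (m + 2 * b) * Z' * hU - 2 * (m + 2 * a) * Z * hU'
    - 4 * (m / 2 + a - 1) * (Y - A) * hZ' - 4 * (m / 2 + b - 1) * (Y' - B) * hZ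
    + 4 * (k - a) * A * hY' + 4 * (l - b) * B * hY

theorem move_left (η : S → ℕ) {x y : S} (h : x ≠ y) : move η x y x = η x - 1 := by
  simp [move, h]

theorem move_right (η : S → ℕ) {x y : S} (h : x ≠ y) : move η x y y = η y + 1 := by
  simp [move, h.symm]

theorem move_of_ne (η : S → ℕ) {x y z : S} (hx : z ≠ x) (hy : z ≠ y) : move η x y z = η z := by
  simp [move, hx, hy]

theorem duality_eq_prod (hm : 0 < m) {ξ : S → ℕ} (η : S → ℕ) {F : Finset S}
    (hF : ∀ z ∉ F, ξ z = 0) : duality m ξ η = ∏ z ∈ F, singleDuality m (ξ z) (η z) := by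
  refine finprod_eq_prod_of_mulSupport_subset _ fun z hz => ?_
  by_contra hzF
  exact hz (by simp [hF z hzF, singleDuality_zero hm])

/-- The factor M collects the sites other than x and y. It does not depend on how the two
configurations are changed at x and y, so all terms of the bond identity share it. -/
theorem exists_duality_eq_mul (hm : 0 < m) {ξ : S → ℕ} (η : S → ℕ) {F : Finset S}
    (hF : ∀ z ∉ F, ξ z = 0) {x y : S} (hxy : x ≠ y) :
    ∃ M : ℝ, ∀ ξ' η' : S → ℕ, (∀ z, z ≠ x → z ≠ y → ξ' z = ξ z ∧ η' z = η z) →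
      duality m ξ' η' =
        M * (singleDuality m (ξ' x) (η' x) * singleDuality m (ξ' y) (η' y)) := by
  classical
  set F' := insert x (insert y F)
  refine ⟨∏ z ∈ (F'.erase x).erase y, singleDuality m (ξ z) (η z), fun ξ' η' h => ?_⟩
  have hF' : ∀ z ∉ F', ξ' z = 0 := by
    intro z hz
    simp only [F', Finset.mem_insert, not_or] at hz
    rw [(h z hz.1 hz.2.1).1, hF z hz.2.2]
  rw [duality_eq_prod hm η' hF', ← Finset.mul_prod_erase F' _ (a := x) (by simp [F']),
    ← Finset.mul_prod_erase (F'.erase x) _ (a := y) (by simp [F', hxy.symm])]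
  have : ∏ z ∈ (F'.erase x).erase y, singleDuality m (ξ' z) (η' z) =
      ∏ z ∈ (F'.erase x).erase y, singleDuality m (ξ z) (η z) := by
    refine Finset.prod_congr rfl fun z hz => ?_
    simp only [Finset.mem_erase] at hz
    rw [(h z hz.2.1 hz.1).1, (h z hz.2.1 hz.1).2]
  rw [this]
  ring

theorem duality_bond (hm : 0 < m) {ξ : S → ℕ} (η : S → ℕ) {F : Finset S}
    (hF : ∀ z ∉ F, ξ z = 0) {x y : S} (hxy : x ≠ y) :
    (2 * (η x : ℝ)) * (m + 2 * η y) * (duality m ξ (move η x y) - duality m ξ η) +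
      (2 * (η y : ℝ)) * (m + 2 * η x) * (duality m ξ (move η y x) - duality m ξ η) =
    (2 * (ξ x : ℝ)) * (m + 2 * ξ y) * (duality m (move ξ x y) η - duality m ξ η) +
      (2 * (ξ y : ℝ)) * (m + 2 * ξ x) * (duality m (move ξ y x) η - duality m ξ η) := by
  obtain ⟨M, hM⟩ := exists_duality_eq_mul hm η hF hxy
  rw [hM ξ η (by simp), hM ξ (move η x y) (fun z h1 h2 => ⟨rfl, move_of_ne η h1 h2⟩),
    hM ξ (move η y x) (fun z h1 h2 => ⟨rfl, move_of_ne η h2 h1⟩),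
    hM (move ξ x y) η (fun z h1 h2 => ⟨move_of_ne ξ h1 h2, rfl⟩),
    hM (move ξ y x) η (fun z h1 h2 => ⟨move_of_ne ξ h2 h1, rfl⟩)]
  simp only [move_left _ hxy, move_right _ hxy, move_left _ hxy.symm, move_right _ hxy.symm]
  linear_combination M * singleDuality_bond hm (ξ x) (ξ y) (η x) (η y)

theorem duality_congr_right {ξ η η' : S → ℕ} (hm : 0 < m) (h : ∀ z, ξ z ≠ 0 → η z = η' z) :
    duality m ξ η = duality m ξ η' := by
  unfold duality
  congr 1
  funext z
  by_cases hz : ξ z = 0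
  · simp [hz, singleDuality_zero hm]
  · rw [h z hz]

open Classical in
theorem config_eq_zero {n : ℕ} (x : Fin n → S) {z : S} (hz : z ∉ Finset.univ.image x) :
    config x z = 0 := by
  simp only [Finset.mem_image, Finset.mem_univ, true_and, not_exists] at hz
  simp [config, hz]

open Classical in
theorem config_eq_add {n : ℕ} (x : Fin n → S) (i : Fin n) (z : S) :
    config x z = (if x i = z then 1 else 0) +
      ∑ j ∈ Finset.univ.erase i, if x j = z then 1 else 0 := by
  rw [config, Finset.add_sum_erase _ (fun j => if x j = z then 1 else 0) (Finset.mem_univ i)]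

open Classical in
theorem config_update {n : ℕ} (x : Fin n → S) (i : Fin n) {y : S} (h : x i ≠ y) :
    config (Function.update x i y) = move (config x) (x i) y := by
  have key : ∀ z, config (Function.update x i y) z = (if y = z then 1 else 0) +
      ∑ j ∈ Finset.univ.erase i, if x j = z then 1 else 0 := by
    intro z
    rw [config_eq_add _ i, Function.update_self]
    congr 1
    refine Finset.sum_congr rfl fun j hj => ?_
    rw [Function.update_of_ne (Finset.ne_of_mem_erase hj)]
  funext z
  rw [key]
  by_cases h1 : z = x i
  · subst h1
    rw [move_left _ h, config_eq_add x i, if_neg h.symm]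
    simp
  · by_cases h2 : z = y
    · subst h2
      rw [move_right _ h, config_eq_add x i, if_neg h]
      simp [add_comm]
    · rw [move_of_ne _ h1 h2, config_eq_add x i, if_neg (Ne.symm h1), if_neg (Ne.symm h2)]

theorem duality_nonneg (hm : 0 < m) (ξ η : S → ℕ) : 0 ≤ duality m ξ η :=
  finprod_nonneg fun _ => singleDuality_nonneg hm _ _

open Classical in
theorem measurable_duality (hm : 0 < m) {n : ℕ} (x : Fin n → S) :
    Measurable (duality m (config x)) := by
  have : duality m (config x) = fun η => ∏ z ∈ Finset.univ.image x,
      singleDuality m (config x z) (η z) :=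
    funext fun η => duality_eq_prod hm η fun z => config_eq_zero x
  rw [this]
  exact Finset.measurable_fun_prod _ fun z _ =>
    (measurable_from_nat (f := singleDuality m (config x z))).comp (measurable_pi_apply z)

/-- A falling factorial is at most the corresponding power, so the growth exponent is the number of
dual particles. This admits D into Dynkin's formula. -/
theorem isLocalFunction_duality (hm : 0 < m) {n : ℕ} (x : Fin n → S) :
    IsLocalFunction (duality m (config x)) := by
  classical
  set Λ := Finset.univ.image x
  have hΛ : ∀ z ∉ Λ, config x z = 0 := fun z => config_eq_zero x
  set c : S → ℝ := fun z => Real.Gamma (m / 2) / Real.Gamma (m / 2 + config x z)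
  have hc : ∀ z, 0 ≤ c z := fun z => div_nonneg
    (Real.Gamma_pos_of_pos (by positivity)).le (Real.Gamma_pos_of_pos (by positivity)).le
  refine ⟨Λ, fun η η' h => duality_congr_right hm fun z hz => h z ?_,
    ∏ z ∈ Λ, c z, ∑ z ∈ Λ, config x z, fun η => ?_⟩
  · by_contra hzΛ
    exact hz (hΛ z hzΛ)
  · rw [abs_of_nonneg (duality_nonneg hm _ _), duality_eq_prod hm η hΛ, ← Finset.prod_pow_eq_pow_sum,
      ← Finset.prod_mul_distrib]
    refine Finset.prod_le_prod (fun z _ => singleDuality_nonneg hm _ _) fun z hz => ?_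
    rw [singleDuality, mul_comm]
    refine mul_le_mul_of_nonneg_left ?_ (hc z)
    have h1 : ((η z).descFactorial (config x z) : ℝ) ≤ (η z : ℝ) ^ config x z := by
      exact_mod_cast Nat.descFactorial_le_pow _ _
    refine h1.trans (pow_le_pow_left₀ (by positivity) ?_ _)
    have := Finset.single_le_sum (f := fun z => (η z : ℝ)) (fun _ _ => by positivity) hz
    linarith

end Duality

/-! ### The generator of labelled dual particles and the closed equation for duality expectations.
-/

noncomputable section DualOperator

variable {S : Type*} {m : ℝ} {p : S → S → ℝ} {N : S → Finset S} {n : ℕ}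

/-- A bound for the total jump rate of `n` inclusion particles. -/
def dualRate (m : ℝ) (n : ℕ) : ℝ := 2 * m * n + 4 * n ^ 2

/-- The generator of `n` labelled inclusion particles, shifted by `dualRate m n` times the
identity so as to be a nonnegative matrix. The kernel `p` vanishes outside of `N`. -/
def dualOp (m : ℝ) (p : S → S → ℝ) (N : S → Finset S) (n : ℕ) (f : (Fin n → S) → ℝ)
    (x : Fin n → S) : ℝ :=
  ∑ i, ∑ y ∈ N (x i), 2 * m * p (x i) y * f (Function.update x i y) +
    ∑ i, ∑ j, 4 * p (x i) (x j) * f (Function.update x i (x j)) +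
    (4 * n ^ 2 - ∑ i, ∑ j, 4 * p (x i) (x j)) * f x

theorem IsWalkKernel.le_one (hp : IsWalkKernel p) (x y : S) : p x y ≤ 1 :=
  le_hasSum (hp.hasSum_one x) y fun z _ => hp.nonneg x z

theorem IsWalkKernel.sum_eq_one (hp : IsWalkKernel p) (hN : ∀ x, ∀ y ∉ N x, p x y = 0) (x : S) :
    ∑ y ∈ N x, p x y = 1 := by
  rw [← (hp.hasSum_one x).tsum_eq, tsum_eq_sum (hN x)]

theorem IsWalkKernel.sum_sum_le (hp : IsWalkKernel p) (x : Fin n → S) :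
    ∑ i, ∑ j, 4 * p (x i) (x j) ≤ 4 * (n : ℝ) ^ 2 := by
  calc ∑ i, ∑ j, 4 * p (x i) (x j) ≤ ∑ _i : Fin n, ∑ _j : Fin n, (4 : ℝ) := by
        refine Finset.sum_le_sum fun i _ => Finset.sum_le_sum fun j _ => ?_
        linarith [hp.le_one (x i) (x j)]
    _ = _ := by simp; ring

theorem finitePositive_dualOp (hm : 0 < m) (hp : IsWalkKernel p) :
    FinitePositive (dualOp m p N n) := by
  refine FinitePositive.add (FinitePositive.add ?_ ?_) ?_
  · refine finitePositive_sum (fun _ => Finset.univ) fun i => ?_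
    refine finitePositive_sum (fun x : Fin n → S => N (x i)) fun y => ?_
    exact finitePositive_single (g := fun x : Fin n → S => Function.update x i y)
      (r := fun x => 2 * m * p (x i) y) fun x => mul_nonneg (by positivity) (hp.nonneg _ _)
  · refine finitePositive_sum (fun _ => Finset.univ) fun i => ?_
    refine finitePositive_sum (fun _ => Finset.univ) fun j => ?_
    exact finitePositive_single (g := fun x : Fin n → S => Function.update x i (x j))
      (r := fun x => 4 * p (x i) (x j)) fun x => mul_nonneg (by positivity) (hp.nonneg _ _)
  · exact finitePositive_single (g := fun x => x)
      (r := fun x => 4 * (n : ℝ) ^ 2 - ∑ i, ∑ j, 4 * p (x i) (x j))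
      fun x => sub_nonneg.2 (hp.sum_sum_le x)

theorem dualOp_sub_dualRate (hp : IsWalkKernel p) (hN : ∀ x, ∀ y ∉ N x, p x y = 0)
    (f : (Fin n → S) → ℝ) (x : Fin n → S) :
    dualOp m p N n f x - dualRate m n * f x =
      ∑ i, ∑ y ∈ N (x i), 2 * m * p (x i) y * (f (Function.update x i y) - f x) +
      ∑ i, ∑ j, 4 * p (x i) (x j) * (f (Function.update x i (x j)) - f x) := by
  simp only [mul_sub, Finset.sum_sub_distrib, ← Finset.sum_mul, ← Finset.mul_sum,
    hp.sum_eq_one hN, dualOp, dualRate]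
  simp
  ring

/-- Self-duality of the generator of the inclusion process. -/
theorem generator_duality (hm : 0 < m) (hp : IsWalkKernel p) (hN : ∀ x, ∀ y ∉ N x, p x y = 0)
    (x : Fin n → S) (η : S → ℕ) :
    generator m p (duality m (config x)) η =
      dualOp m p N n (fun x => duality m (config x) η) x -
        dualRate m n * duality m (config x) η := by
  classical
  rw [dualOp_sub_dualRate hp hN]
  set ξ := config x with hξ
  set Λ := Finset.univ.image x
  set Λ' := Λ ∪ Λ.biUnion N
  have hΛ : ∀ z ∉ Λ, ξ z = 0 := fun z => config_eq_zero x
  have hout : ∀ z ∈ Λ, ∀ w ∉ Λ', p z w = 0 := by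
    intro z hz w hw
    refine hN z w fun h => hw ?_
    exact Finset.mem_union_right _ (Finset.mem_biUnion.2 ⟨z, hz, h⟩)
  have hsub : Λ ⊆ Λ' := Finset.subset_union_left
  have hxΛ : ∀ i, x i ∈ Λ := fun i => Finset.mem_image_of_mem x (Finset.mem_univ i)
  set G : S → S → ℝ := fun z w => p z w * (2 * (η z : ℝ)) * (m + 2 * (η w : ℝ)) *
    (duality m ξ (move η z w) - duality m ξ η) with hG
  set H : S → S → ℝ := fun z w => p z w * (2 * (ξ z : ℝ)) * (m + 2 * (ξ w : ℝ)) *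
    (duality m (move ξ z w) η - duality m ξ η) with hH
  -- A bond contributes only if one end carries a dual particle; the other end is then a neighbour
  -- of it. This makes the infinite sum finite.
  have hgen : generator m p (duality m ξ) η = ∑ z ∈ Λ', ∑ w ∈ Λ', G z w := by
    rw [← Finset.sum_product', generator]
    refine tsum_eq_sum fun e he => ?_
    obtain ⟨z, w⟩ := e
    simp only [Finset.mem_product, not_and_or] at he
    by_cases hz : z ∈ Λ
    · have hw : w ∉ Λ' := he.resolve_left fun h => h (hsub hz)
      simp [hout z hz w hw]
    · by_cases hw : w ∈ Λ
      · have hz' : z ∉ Λ' := he.resolve_right fun h => h (hsub hw)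
        simp [hp.symm z w, hout w hw z hz']
      · have : duality m ξ (move η z w) = duality m ξ η := by
          refine duality_congr_right hm fun u hu => move_of_ne η ?_ ?_ <;> rintro rfl
          · exact hu (hΛ _ hz)
          · exact hu (hΛ _ hw)
        simp [this]
  -- Duality holds only after adding both orientations of a bond; symmetry of p provides the common
  -- factor.
  have hbond : ∀ z w, G z w + G w z = H z w + H w z := by
    intro z w
    by_cases hzw : z = w
    · subst hzw
      simp [hG, hH, hp.diag]
    · have := duality_bond hm η hΛ hzw
      simp only [hG, hH, hp.symm w z]
      linear_combination p z w * this
  have hGH : ∑ z ∈ Λ', ∑ w ∈ Λ', G z w = ∑ z ∈ Λ', ∑ w ∈ Λ', H z w := by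
    have h1 : ∑ z ∈ Λ', ∑ w ∈ Λ', (G z w + G w z) = ∑ z ∈ Λ', ∑ w ∈ Λ', (H z w + H w z) :=
      Finset.sum_congr rfl fun z _ => Finset.sum_congr rfl fun w _ => hbond z w
    simp only [Finset.sum_add_distrib] at h1
    rw [Finset.sum_comm (f := fun z w => G w z), Finset.sum_comm (f := fun z w => H w z)] at h1
    linarith
  rw [hgen, hGH]
  have hcast : ∀ z, (ξ z : ℝ) = ∑ i, if x i = z then (1 : ℝ) else 0 := by
    intro z
    simp [hξ, config]
  -- Passes from sites weighted by multiplicity to labelled particles.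
  have hcollapse : ∀ F : S → ℝ, ∑ z ∈ Λ', (ξ z : ℝ) * F z = ∑ i, F (x i) := by
    intro F
    simp only [hcast, Finset.sum_mul]
    rw [Finset.sum_comm]
    refine Finset.sum_congr rfl fun i _ => ?_
    simp only [ite_mul, one_mul, zero_mul]
    rw [Finset.sum_ite_eq, if_pos (hsub (hxΛ i))]
  have hmove : ∀ i w, p (x i) w * (duality m (move ξ (x i) w) η - duality m ξ η) =
      p (x i) w * (duality m (config (Function.update x i w)) η - duality m ξ η) := by
    intro i w
    by_cases hw : x i = w
    · rw [← hw, hp.diag]; simp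
    · rw [config_update x i hw]
  -- The part m of the rate gives the free walk, the part 2 ξ_w the jumps towards each particle j.
  -- The term j = i, the attraction of a particle by itself, vanishes since p has zero diagonal.
  have hrow : ∀ i, ∑ w ∈ Λ', 2 * p (x i) w * (m + 2 * (ξ w : ℝ)) *
        (duality m (move ξ (x i) w) η - duality m ξ η) =
      ∑ y ∈ N (x i), 2 * m * p (x i) y *
          (duality m (config (Function.update x i y)) η - duality m ξ η) +
        ∑ j, 4 * p (x i) (x j) *
          (duality m (config (Function.update x i (x j))) η - duality m ξ η) := by
    intro i
    have h1 : ∑ y ∈ N (x i), 2 * m * p (x i) y *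
          (duality m (config (Function.update x i y)) η - duality m ξ η) =
        ∑ y ∈ Λ', 2 * m * p (x i) y *
          (duality m (config (Function.update x i y)) η - duality m ξ η) := by
      refine Finset.sum_subset (fun y hy => Finset.mem_union_right _
        (Finset.mem_biUnion.2 ⟨x i, hxΛ i, hy⟩)) fun y _ hy => ?_
      rw [hN _ _ hy]
      ring
    rw [h1, ← hcollapse (fun w => 4 * p (x i) w *
      (duality m (config (Function.update x i w)) η - duality m ξ η)), ← Finset.sum_add_distrib]
    refine Finset.sum_congr rfl fun w _ => ?_
    linear_combination 2 * (m + 2 * (ξ w : ℝ)) * hmove i w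
  rw [← Finset.sum_add_distrib, ← Finset.sum_congr rfl fun i _ => hrow i,
    ← hcollapse fun z => ∑ w ∈ Λ', 2 * p z w * (m + 2 * (ξ w : ℝ)) *
        (duality m (move ξ z w) η - duality m ξ η)]
  refine Finset.sum_congr rfl fun z _ => ?_
  rw [Finset.mul_sum]
  refine Finset.sum_congr rfl fun w _ => ?_
  simp only [hH]
  ring

/-- The duality expectations of the inclusion process are given by the exponential series of the
dual generator. -/
theorem IsSIPSemigroup.hasSum_integral_duality {X : Set (S → ℕ)}
    {P : ℝ≥0 → Kernel (S → ℕ) (S → ℕ)} (hm : 0 < m) (hp : IsWalkKernel p)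
    (hN : ∀ x, ∀ y ∉ N x, p x y = 0) (hP : IsSIPSemigroup m p X P) {η : S → ℕ} (hη : η ∈ X)
    (t : ℝ≥0) (x : Fin n → S) :
    HasSum (fun k => Real.exp (-(dualRate m n * t)) * ((t : ℝ) ^ k / (k ! : ℝ) *
        (dualOp m p N n)^[k] (fun x => duality m (config x) η) x))
      (∫ ζ, duality m (config x) ζ ∂(P t η)) := by
  set a := dualRate m n
  set A := dualOp m p N n
  have hA : FinitePositive A := finitePositive_dualOp hm hp
  set u : ℝ → (Fin n → S) → ℝ := fun s x => ∫ ζ, duality m (config x) ζ ∂(P s.toNNReal η) with hu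
  have hInt : ∀ (s : ℝ≥0) (x : Fin n → S), Integrable (duality m (config x)) (P s η) :=
    fun s x => hP.integrable _ (isLocalFunction_duality hm x) s η hη
  have hgen : ∀ (s : ℝ) (x : Fin n → S), ∫ ζ, generator m p (duality m (config x)) ζ
      ∂(P s.toNNReal η) = A (u s) x - a * u s x := by
    intro s x
    simp only [generator_duality hm hp hN]
    rw [integral_sub (hA.integrable (fun x => hInt _ x) x) ((hInt _ x).const_mul _),
      hA.integral (fun x => hInt _ x), integral_const_mul]
  have hu0 : ∀ x, u 0 x = duality m (config x) η := by
    intro x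
    simp only [hu, Real.toNNReal_zero, hP.zero η hη]
    exact integral_dirac' _ _ (measurable_duality hm x).stronglyMeasurable
  have hII : ∀ (t : ℝ) (x : Fin n → S), 0 ≤ t →
      IntervalIntegrable (fun s => A (u s) x - a * u s x) volume 0 t := by
    intro t x ht
    have := hP.integrable_generator _ (isLocalFunction_duality hm x) ⟨t, ht⟩ η hη
    simp only [hgen] at this
    exact this
  have hdyn : ∀ (t : ℝ) (x : Fin n → S), 0 ≤ t →
      u t x = u 0 x + ∫ s in (0 : ℝ)..t, (A (u s) x - a * u s x) := by
    intro t x ht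
    have := hP.dynkin _ (isLocalFunction_duality hm x) ⟨t, ht⟩ η hη
    simp only [hgen] at this
    rw [hu0]
    simp only [hu, Real.toNNReal_of_nonneg ht]
    exact this
  -- Continuity in time is not among the axioms of the semigroup; it comes from Dynkin's formula, as
  -- u is a primitive of an integrable function.
  have hcontOn : ∀ x, ContinuousOn (fun t => u t x) (Set.Ici 0) := by
    intro x t ht
    have ht0 : (0 : ℝ) ≤ t := ht
    have h1 : ContinuousOn (fun t => u 0 x + ∫ s in (0 : ℝ)..t, (A (u s) x - a * u s x))
        (Set.uIcc 0 (t + 1)) :=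
      continuousOn_const.add
        (intervalIntegral.continuousOn_primitive_interval' (hII (t + 1) x (by linarith)) (by simp))
    rw [Set.uIcc_of_le (by linarith)] at h1
    have h2 : ContinuousOn (fun t => u t x) (Set.Icc 0 (t + 1)) :=
      h1.congr fun s hs => hdyn s x hs.1
    refine (h2 t ⟨ht0, by linarith⟩).mono_of_mem_nhdsWithin ?_
    rw [← Set.Ici_inter_Iic]
    exact Filter.inter_mem self_mem_nhdsWithin
      (mem_nhdsWithin_of_mem_nhds (Iic_mem_nhds (by linarith)))
  have hcont : ∀ x, Continuous fun t => u t x := by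
    intro x
    -- `Real.toNNReal` clamps negative times to 0, so u is constant there and continuity extends to
    -- the whole line.
    have h1 : (fun t => u t x) = fun t => u (max t 0) x := by
      funext t
      simp only [hu]
      congr 2
      simp [Real.toNNReal]
    rw [h1]
    exact (hcontOn x).comp_continuous (by fun_prop) fun t => le_max_right t 0
  -- The exponential factor absorbs the diagonal term -a u and leaves v' = A v with A nonnegative.
  set v : ℝ → (Fin n → S) → ℝ := fun s x => Real.exp (a * s) * u s x with hv
  have hvcont : ∀ x, Continuous fun t => v t x := fun x =>
    (by fun_prop : Continuous fun t : ℝ => Real.exp (a * t)).mul (hcont x)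
  have hv0 : ∀ t x, 0 ≤ v t x := fun t x =>
    mul_nonneg (Real.exp_pos _).le (integral_nonneg fun ζ => duality_nonneg hm _ _)
  have hder : ∀ t, 0 < t → ∀ x, HasDerivAt (fun t => v t x) (A (v t) x) t := by
    intro t ht x
    have hc : Continuous fun s => A (u s) x - a * u s x :=
      (hA.continuous hcont x).sub ((hcont x).const_mul a)
    have h1 : HasDerivAt (fun t => u t x) (A (u t) x - a * u t x) t := by
      have h2 := (hc.integral_hasStrictDerivAt 0 t).hasDerivAt.const_add (u 0 x)
      refine h2.congr_of_eventuallyEq ?_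
      filter_upwards [Ioi_mem_nhds ht] with s hs
      exact hdyn s x (le_of_lt hs)
    have h3 : HasDerivAt (fun t : ℝ => Real.exp (a * t)) (Real.exp (a * t) * (a * 1)) t :=
      ((hasDerivAt_id t).const_mul a).exp
    convert! h3.mul h1 using 1
    simp only [hv]
    rw [hA.map_const_mul]
    ring
  have heq : ∀ t, 0 ≤ t → ∀ x, v t x = v 0 x + ∫ s in (0 : ℝ)..t, A (v s) x := by
    intro t ht x
    rw [intervalIntegral.integral_eq_sub_of_hasDerivAt_of_le ht (hvcont x).continuousOn
      (fun s hs => hder s hs.1 x) ((hA.continuous hvcont x).intervalIntegrable _ _)]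
    ring
  have hsum := (hA.hasSum_of_integral_eq hv0 hvcont heq t.coe_nonneg x).mul_left (Real.exp (-(a * t)))
  have hv00 : v 0 = fun x => duality m (config x) η := by
    funext x
    simp [hv, hu0]
  rw [hv00] at hsum
  have hvt : Real.exp (-(a * t)) * v t x = ∫ ζ, duality m (config x) ζ ∂(P t η) := by
    simp only [hv, hu]
    rw [← mul_assoc, ← Real.exp_add, neg_add_cancel, Real.exp_zero, one_mul, Real.toNNReal_coe]
  rwa [hvt] at hsum

end DualOperator

/-! ### Moments of the initial measure and the exponential formula at time t. -/

noncomputable section LocalStationary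

variable {S : Type*} {m : ℝ} {l : ℝ}

theorem discreteGammaWeight_nonneg (hm : 0 < m) (hl : l ∈ Set.Ico (0 : ℝ) 1) (n : ℕ) :
    0 ≤ discreteGammaWeight m l n := by
  have h1 := hl.1
  have h2 : 0 < 1 - l := by linarith [hl.2]
  have h3 := Real.Gamma_pos_of_pos (show 0 < m / 2 + n by positivity)
  have h4 := Real.Gamma_pos_of_pos (show 0 < m / 2 by positivity)
  unfold discreteGammaWeight
  positivity

/-- Size-biasing a discrete gamma law by the duality function gives, up to a shift by k, the
discrete gamma law with parameter m + 2k. Its total mass being 1, the moment is the prefactor. -/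
theorem discreteGammaWeight_mul_singleDuality (hm : 0 < m) (hl : l ∈ Set.Ico (0 : ℝ) 1)
    (k n : ℕ) : discreteGammaWeight m l (n + k) * singleDuality m k (n + k) =
      (l / (1 - l)) ^ k * discreteGammaWeight (m + 2 * k) l n := by
  have h2 : 0 < 1 - l := by linarith [hl.2]
  have h3 := (Real.Gamma_pos_of_pos (show 0 < m / 2 + k by positivity)).ne'
  have h4 := (Real.Gamma_pos_of_pos (show 0 < m / 2 by positivity)).ne'
  have h5 : (0 : ℝ) < 1 / (1 - l) := by positivity
  have h6 := (Real.rpow_pos_of_pos h5 (m / 2)).ne'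
  have hfac : ((n + k)! : ℝ) = (n ! : ℝ) * ((n + k).descFactorial k : ℝ) := by
    have := Nat.factorial_mul_descFactorial (Nat.le_add_left k n)
    rw [Nat.add_sub_cancel] at this
    exact_mod_cast this.symm
  have h7 : ((n + k).descFactorial k : ℝ) ≠ 0 := by
    intro h
    rw [h, mul_zero] at hfac
    exact (by positivity : ((n + k)! : ℝ) ≠ 0) hfac
  have e1 : (m + 2 * k) / 2 = m / 2 + k := by ring
  have e2 : m / 2 + (k : ℝ) + n = m / 2 + ((n + k : ℕ) : ℝ) := by push_cast; ring
  unfold discreteGammaWeight singleDuality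
  rw [hfac, e1, e2, Real.rpow_add_natCast h5.ne']
  field_simp
  ring

theorem hasSum_weight_mul_singleDuality (hm : 0 < m) (hl : l ∈ Set.Ico (0 : ℝ) 1) (k : ℕ) :
    HasSum (fun n => discreteGammaWeight m l n * singleDuality m k n) ((l / (1 - l)) ^ k) := by
  rw [← hasSum_nat_add_iff' k]
  have hz : ∑ i ∈ Finset.range k, discreteGammaWeight m l i * singleDuality m k i = 0 := by
    refine Finset.sum_eq_zero fun i hi => ?_
    simp [singleDuality, Nat.descFactorial_of_lt (Finset.mem_range.1 hi)]
  rw [hz, sub_zero]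
  simp only [discreteGammaWeight_mul_singleDuality hm hl]
  have := (hasSum_discreteGammaWeight (m := m + 2 * k) (by positivity) hl).mul_left
    ((l / (1 - l)) ^ k)
  rwa [mul_one] at this

theorem lintegral_singleDuality (hm : 0 < m) (hl : l ∈ Set.Ico (0 : ℝ) 1) (k : ℕ) :
    ∫⁻ n, ENNReal.ofReal (singleDuality m k n) ∂(discreteGamma m l) =
      ENNReal.ofReal ((l / (1 - l)) ^ k) := by
  have hs := hasSum_weight_mul_singleDuality hm hl k
  rw [discreteGamma, lintegral_sum_measure, ← hs.tsum_eq, ENNReal.ofReal_tsum_of_nonneg _ hs.summable]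
  · refine tsum_congr fun n => ?_
    rw [lintegral_smul_measure, lintegral_dirac, smul_eq_mul,
      ENNReal.ofReal_mul (discreteGammaWeight_nonneg hm hl n)]
  · exact fun n => mul_nonneg (discreteGammaWeight_nonneg hm hl n) (singleDuality_nonneg hm k n)

theorem integrable_singleDuality (hm : 0 < m) (hl : l ∈ Set.Ico (0 : ℝ) 1) (k : ℕ) :
    Integrable (singleDuality m k) (discreteGamma m l) := by
  refine ⟨measurable_from_nat.aestronglyMeasurable, ?_⟩
  rw [hasFiniteIntegral_iff_ofReal (ae_of_all _ (singleDuality_nonneg hm k)),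
    lintegral_singleDuality hm hl]
  exact ENNReal.ofReal_lt_top

theorem integral_singleDuality (hm : 0 < m) (hl : l ∈ Set.Ico (0 : ℝ) 1) (k : ℕ) :
    ∫ n, singleDuality m k n ∂(discreteGamma m l) = (l / (1 - l)) ^ k := by
  have h1 : 0 < 1 - l := by linarith [hl.2]
  have h0 := hl.1
  rw [integral_eq_lintegral_of_nonneg_ae (ae_of_all _ (singleDuality_nonneg hm k))
    measurable_from_nat.aestronglyMeasurable, lintegral_singleDuality hm hl,
    ENNReal.toReal_ofReal (by positivity)]

variable {lam : S → ℝ}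

theorem duality_eq_prod_restrict (hm : 0 < m) {ξ : S → ℕ} {F : Finset S}
    (hF : ∀ z ∉ F, ξ z = 0) :
    duality m ξ = fun η => ∏ z : F, singleDuality m (ξ z) (F.restrict η z) := by
  funext η
  rw [duality_eq_prod hm η hF, ← Finset.prod_coe_sort _ fun z => singleDuality m (ξ z) (η z)]
  rfl

theorem integrable_duality_localStationary (hm : 0 < m) (hlam : ∀ x, lam x ∈ Set.Ico (0 : ℝ) 1)
    {n : ℕ} (x : Fin n → S) : Integrable (duality m (config x)) (localStationary m lam) := by
  classical
  have := fun x => isProbabilityMeasure_discreteGamma hm (hlam x)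
  set Λ : Finset S := Finset.univ.image x
  have h : Integrable (fun η : Λ → ℕ => ∏ z : Λ, singleDuality m (config x z) (η z))
      (Measure.pi fun z : Λ => discreteGamma m (lam z)) :=
    Integrable.fintype_prod fun z => integrable_singleDuality hm (hlam z) _
  rw [← Measure.infinitePi_map_restrict (μ := fun z => discreteGamma m (lam z))] at h
  rw [duality_eq_prod_restrict hm fun z => config_eq_zero x]
  exact h.comp_measurable (by fun_prop)

theorem integral_duality_localStationary (hm : 0 < m) (hlam : ∀ x, lam x ∈ Set.Ico (0 : ℝ) 1)
    {n : ℕ} (x : Fin n → S) :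
    ∫ η, duality m (config x) η ∂(localStationary m lam) =
      ∏ i, (lam (x i) / (1 - lam (x i))) := by
  classical
  have := fun x => isProbabilityMeasure_discreteGamma hm (hlam x)
  set Λ : Finset S := Finset.univ.image x
  have hmeas : Measurable fun η : Λ → ℕ => ∏ z : Λ, singleDuality m (config x z) (η z) :=
    Finset.measurable_fun_prod _ fun z _ =>
      (measurable_from_nat (f := singleDuality m (config x z))).comp (measurable_pi_apply z)
  rw [duality_eq_prod_restrict hm fun z => config_eq_zero x]
  refine (integral_restrict_infinitePi (μ := fun z => discreteGamma m (lam z)) (s := Λ)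
    hmeas.aestronglyMeasurable).trans ?_
  rw [integral_fintype_prod_eq_prod (𝕜 := ℝ) (fun (z : Λ) k => singleDuality m (config x z) k)]
  simp only [integral_singleDuality hm (hlam _)]
  -- The product over occupied sites with multiplicities is regrouped as a product over particles.
  rw [Finset.prod_coe_sort _ fun z => (lam z / (1 - lam z)) ^ config x z,
    Finset.prod_comp (fun z => lam z / (1 - lam z)) x]
  refine Finset.prod_congr rfl fun z _ => ?_
  congr 1
  simp [config]

variable {p : S → S → ℝ} {N : S → Finset S} {n : ℕ}

theorem prod_update (W : S → ℝ) (x : Fin n → S) (i : Fin n) (y : S) :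
    ∏ j, W (Function.update x i y j) = (∏ j ∈ Finset.univ.erase i, W (x j)) * W y := by
  rw [← Finset.prod_erase_mul _ _ (Finset.mem_univ i), Function.update_self]
  congr 1
  refine Finset.prod_congr rfl fun j hj => ?_
  rw [Function.update_of_ne (Finset.ne_of_mem_erase hj)]

theorem dualRate_nonneg (hm : 0 < m) : 0 ≤ dualRate m n := by
  unfold dualRate
  positivity

/-- A jump changes a single factor, at cost at most c, and the total weight of the operator is
`dualRate m n`. The diagonal term changes nothing, which is where 1 ≤ c enters. -/
theorem dualOp_prod_le (hm : 0 < m) (hp : IsWalkKernel p) (hN : ∀ x, ∀ y ∉ N x, p x y = 0)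
    {W : S → ℝ} {c : ℝ} (hW : ∀ x, 0 ≤ W x) (hc : 1 ≤ c)
    (hWc : ∀ x y, p x y ≠ 0 → W y ≤ c * W x) (x : Fin n → S) :
    dualOp m p N n (fun x => ∏ i, W (x i)) x ≤ dualRate m n * c * ∏ i, W (x i) := by
  set V := ∏ i, W (x i) with hV
  have hV0 : 0 ≤ V := Finset.prod_nonneg fun i _ => hW _
  have hup : ∀ i y, p (x i) y * ∏ j, W (Function.update x i y j) ≤ p (x i) y * (c * V) := by
    intro i y
    by_cases h : p (x i) y = 0
    · simp [h]
    · refine mul_le_mul_of_nonneg_left ?_ (hp.nonneg _ _)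
      have h0 : 0 ≤ ∏ j ∈ Finset.univ.erase i, W (x j) := Finset.prod_nonneg fun j _ => hW _
      rw [prod_update, hV, ← Finset.prod_erase_mul _ _ (Finset.mem_univ i)]
      nlinarith [mul_le_mul_of_nonneg_left (hWc _ _ h) h0]
  have h1 : ∑ i, ∑ y ∈ N (x i), 2 * m * p (x i) y * ∏ j, W (Function.update x i y j) ≤
      2 * m * n * (c * V) := by
    calc _ ≤ ∑ i, ∑ y ∈ N (x i), 2 * m * (p (x i) y * (c * V)) := by
          refine Finset.sum_le_sum fun i _ => Finset.sum_le_sum fun y _ => ?_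
          rw [mul_assoc]
          exact mul_le_mul_of_nonneg_left (hup i y) (by positivity)
      _ = _ := by
          simp only [← Finset.mul_sum, ← Finset.sum_mul, hp.sum_eq_one hN]
          simp
          ring
  have h2 : ∑ i, ∑ j, 4 * p (x i) (x j) * ∏ k, W (Function.update x i (x j) k) ≤
      (∑ i, ∑ j, 4 * p (x i) (x j)) * (c * V) := by
    simp only [Finset.sum_mul]
    refine Finset.sum_le_sum fun i _ => Finset.sum_le_sum fun j _ => ?_
    rw [mul_assoc, mul_assoc]
    exact mul_le_mul_of_nonneg_left (hup i (x j)) (by positivity)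
  have h3 : (4 * (n : ℝ) ^ 2 - ∑ i, ∑ j, 4 * p (x i) (x j)) * V ≤
      (4 * (n : ℝ) ^ 2 - ∑ i, ∑ j, 4 * p (x i) (x j)) * (c * V) := by
    refine mul_le_mul_of_nonneg_left ?_ (sub_nonneg.2 (hp.sum_sum_le x))
    nlinarith
  calc dualOp m p N n (fun x => ∏ i, W (x i)) x
      ≤ 2 * m * n * (c * V) + (∑ i, ∑ j, 4 * p (x i) (x j)) * (c * V) +
        (4 * (n : ℝ) ^ 2 - ∑ i, ∑ j, 4 * p (x i) (x j)) * (c * V) :=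
        add_le_add (add_le_add h1 h2) h3
    _ = dualRate m n * c * V := by unfold dualRate; ring

theorem abs_iterate_dualOp_le (hm : 0 < m) (hp : IsWalkKernel p)
    (hN : ∀ x, ∀ y ∉ N x, p x y = 0) {r W : S → ℝ} {c : ℝ} (hr : ∀ x, 0 ≤ r x)
    (hrW : ∀ x, r x ≤ W x) (hc : 1 ≤ c) (hWc : ∀ x y, p x y ≠ 0 → W y ≤ c * W x) (k : ℕ)
    (x : Fin n → S) : |(dualOp m p N n)^[k] (fun x => ∏ i, r (x i)) x| ≤
      (∏ i, W (x i)) * (dualRate m n * c) ^ k := by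
  have hA := finitePositive_dualOp (N := N) (n := n) hm hp
  have hd := dualRate_nonneg (n := n) hm
  rw [abs_of_nonneg (hA.iterate_nonneg (fun x => Finset.prod_nonneg fun i _ => hr _) k x), mul_comm]
  exact hA.iterate_le (by positivity)
    (dualOp_prod_le hm hp hN (fun x => (hr x).trans (hrW x)) hc hWc)
    (fun x => Finset.prod_le_prod (fun i _ => hr _) fun i _ => hrW _) k x

variable {X : Set (S → ℕ)} {P : ℝ≥0 → Kernel (S → ℕ) (S → ℕ)} {W : S → ℝ} {c : ℝ}

/-- All terms are nonnegative, so Tonelli exchanges the series with the initial integral. Each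
iterate of `dualOp` is a finite combination of duality functions, hence can be integrated termwise.
The weight W is used to sum the resulting series. -/
theorem lintegral_duality_bind (hm : 0 < m) (hp : IsWalkKernel p)
    (hN : ∀ x, ∀ y ∉ N x, p x y = 0) (hP : IsSIPSemigroup m p X P)
    (hlam : ∀ x, lam x ∈ Set.Ico (0 : ℝ) 1) (hX : ∀ᵐ η ∂(localStationary m lam), η ∈ X)
    (hrW : ∀ x, lam x / (1 - lam x) ≤ W x) (hc : 1 ≤ c)
    (hWc : ∀ x y, p x y ≠ 0 → W y ≤ c * W x) (t : ℝ≥0) (x : Fin n → S) :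
    ∫⁻ ζ, ENNReal.ofReal (duality m (config x) ζ) ∂((localStationary m lam).bind (P t)) =
      ENNReal.ofReal (Real.exp (-(dualRate m n * t)) * ∑' k, (t : ℝ) ^ k / (k ! : ℝ) *
        (dualOp m p N n)^[k] (fun x => ∏ i, lam (x i) / (1 - lam (x i))) x) := by
  have hr : ∀ x, 0 ≤ lam x / (1 - lam x) := fun x =>
    div_nonneg (hlam x).1 (by linarith [(hlam x).2])
  have hA := finitePositive_dualOp (N := N) (n := n) hm hp
  have hD : ∀ (k : ℕ) (x : Fin n → S), Integrable (fun η => (dualOp m p N n)^[k]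
      (fun x => duality m (config x) η) x) (localStationary m lam) := fun k x =>
    hA.integrable_iterate (fun x => integrable_duality_localStationary hm hlam x) k x
  rw [Measure.lintegral_bind (P t).aemeasurable
    (measurable_duality hm x).ennreal_ofReal.aemeasurable]
  have h1 : ∀ᵐ η ∂(localStationary m lam), ∫⁻ ζ, ENNReal.ofReal (duality m (config x) ζ) ∂(P t η) =
      ∑' k, ENNReal.ofReal (Real.exp (-(dualRate m n * t)) * ((t : ℝ) ^ k / (k ! : ℝ) *
        (dualOp m p N n)^[k] (fun x => duality m (config x) η) x)) := by
    filter_upwards [hX] with η hη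
    have hs := hP.hasSum_integral_duality hm hp hN hη t x
    rw [← ofReal_integral_eq_lintegral_ofReal
      (hP.integrable _ (isLocalFunction_duality hm x) t η hη)
      (ae_of_all _ fun ζ => duality_nonneg hm _ _), ← hs.tsum_eq,
      ENNReal.ofReal_tsum_of_nonneg _ hs.summable]
    exact fun k => mul_nonneg (Real.exp_pos _).le (mul_nonneg (by positivity)
      (hA.iterate_nonneg (fun x => duality_nonneg hm _ _) k x))
  rw [lintegral_congr_ae h1, lintegral_tsum fun k =>
    (((hD k x).const_mul _).const_mul _).aestronglyMeasurable.aemeasurable.ennreal_ofReal]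
  have hb := abs_iterate_dualOp_le (n := n) hm hp hN hr hrW hc hWc
  rw [← tsum_mul_left, ENNReal.ofReal_tsum_of_nonneg]
  · refine tsum_congr fun k => ?_
    rw [← ofReal_integral_eq_lintegral_ofReal (((hD k x).const_mul _).const_mul _),
      integral_const_mul, integral_const_mul,
      hA.integral_iterate fun x => integrable_duality_localStationary hm hlam x]
    · simp only [integral_duality_localStationary hm hlam]
    · exact ae_of_all _ fun η => mul_nonneg (Real.exp_pos _).le (mul_nonneg (by positivity)
        (hA.iterate_nonneg (fun x => duality_nonneg hm _ _) k x))
  · exact fun k => mul_nonneg (Real.exp_pos _).le (mul_nonneg (by positivity)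
      (hA.iterate_nonneg (fun x => Finset.prod_nonneg fun i _ => hr _) k x))
  · exact (summable_expSeries (fun k => hb k x) t).mul_left _

theorem integrable_duality_bind (hm : 0 < m) (hp : IsWalkKernel p)
    (hN : ∀ x, ∀ y ∉ N x, p x y = 0) (hP : IsSIPSemigroup m p X P)
    (hlam : ∀ x, lam x ∈ Set.Ico (0 : ℝ) 1) (hX : ∀ᵐ η ∂(localStationary m lam), η ∈ X)
    (hrW : ∀ x, lam x / (1 - lam x) ≤ W x) (hc : 1 ≤ c)
    (hWc : ∀ x y, p x y ≠ 0 → W y ≤ c * W x) (t : ℝ≥0) (x : Fin n → S) :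
    Integrable (duality m (config x)) ((localStationary m lam).bind (P t)) := by
  refine ⟨(measurable_duality hm x).aestronglyMeasurable, ?_⟩
  rw [hasFiniteIntegral_iff_ofReal (ae_of_all _ fun ζ => duality_nonneg hm _ _),
    lintegral_duality_bind hm hp hN hP hlam hX hrW hc hWc]
  exact ENNReal.ofReal_lt_top

theorem dualityMoment_bind (hm : 0 < m) (hp : IsWalkKernel p)
    (hN : ∀ x, ∀ y ∉ N x, p x y = 0) (hP : IsSIPSemigroup m p X P)
    (hlam : ∀ x, lam x ∈ Set.Ico (0 : ℝ) 1) (hX : ∀ᵐ η ∂(localStationary m lam), η ∈ X)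
    (hrW : ∀ x, lam x / (1 - lam x) ≤ W x) (hc : 1 ≤ c)
    (hWc : ∀ x y, p x y ≠ 0 → W y ≤ c * W x) (t : ℝ≥0) (x : Fin n → S) :
    dualityMoment m ((localStationary m lam).bind (P t)) x =
      Real.exp (-(dualRate m n * t)) * ∑' k, (t : ℝ) ^ k / (k ! : ℝ) *
        (dualOp m p N n)^[k] (fun x => ∏ i, lam (x i) / (1 - lam (x i))) x := by
  have hr : ∀ x, 0 ≤ lam x / (1 - lam x) := fun x =>
    div_nonneg (hlam x).1 (by linarith [(hlam x).2])
  rw [dualityMoment, integral_eq_lintegral_of_nonneg_ae (ae_of_all _ fun ζ => duality_nonneg hm _ _)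
    (measurable_duality hm x).aestronglyMeasurable,
    lintegral_duality_bind hm hp hN hP hlam hX hrW hc hWc, ENNReal.toReal_ofReal]
  exact mul_nonneg (Real.exp_pos _).le (tsum_nonneg fun k => mul_nonneg (by positivity)
    ((finitePositive_dualOp hm hp).iterate_nonneg (fun x => Finset.prod_nonneg fun i _ => hr _) k x))

end LocalStationary

/-! ### Comparison with independent walkers and the correlation inequality. -/

noncomputable section Comparison

variable {S : Type*} {m : ℝ} {p : S → S → ℝ} {N : S → Finset S} {n : ℕ} {W r : S → ℝ} {c : ℝ}

theorem FinitePositive.map_tsum {E : Type*} {A : (E → ℝ) → E → ℝ} (hA : FinitePositive A)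
    {f : ℕ → E → ℝ} (hf : ∀ x, Summable fun k => f k x) (x : E) :
    A (fun y => ∑' k, f k y) x = ∑' k, A (f k) x := by
  obtain ⟨c, hc, hA⟩ := hA x
  simp only [hA, Finsupp.sum]
  rw [Summable.tsum_finsetSum fun y _ => (hf y).mul_left _]
  exact Finset.sum_congr rfl fun y _ => tsum_mul_left.symm

/-- The expectation at time `t` of `r` along the walk of a single particle started at `z`. -/
def walkMean (m : ℝ) (p : S → S → ℝ) (N : S → Finset S) (r : S → ℝ) (t : ℝ) (z : S) : ℝ :=
  Real.exp (-(dualRate m 1 * t)) * ∑' k, t ^ k / (k ! : ℝ) *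
    (dualOp m p N 1)^[k] (fun x => ∏ i, r (x i)) (fun _ => z)

theorem walkMean_zero (z : S) : walkMean m p N r 0 z = r z := by
  rw [walkMean, tsum_eq_single 0]
  · simp
  · intro k hk
    simp [hk]

theorem walkMean_nonneg (hm : 0 < m) (hp : IsWalkKernel p) (hr : ∀ x, 0 ≤ r x) {t : ℝ}
    (ht : 0 ≤ t) (z : S) : 0 ≤ walkMean m p N r t z :=
  mul_nonneg (Real.exp_pos _).le (tsum_nonneg fun k => mul_nonneg (by positivity)
    ((finitePositive_dualOp hm hp).iterate_nonneg (fun x => Finset.prod_nonneg fun i _ => hr _) k _))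

/-- The prefactor is bounded by 1 and the series by its Lyapunov majorant. The bound is crude but
uniform on [0, T], as the comparison principle requires. -/
theorem walkMean_le (hm : 0 < m) (hp : IsWalkKernel p) (hN : ∀ x, ∀ y ∉ N x, p x y = 0)
    (hr : ∀ x, 0 ≤ r x) (hrW : ∀ x, r x ≤ W x) (hc : 1 ≤ c)
    (hWc : ∀ x y, p x y ≠ 0 → W y ≤ c * W x) {t T : ℝ} (ht : t ∈ Set.Icc 0 T) (z : S) :
    walkMean m p N r t z ≤ Real.exp (T * (dualRate m 1 * c)) * W z := by
  have hd := dualRate_nonneg (n := 1) hm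
  have hb := fun k => abs_iterate_dualOp_le (n := 1) hm hp hN hr hrW hc hWc k (fun _ => z)
  simp only [Finset.univ_unique, Finset.prod_singleton] at hb
  have hWz : 0 ≤ W z := (hr z).trans (hrW z)
  have hexp : HasSum (fun k => W z * ((t * (dualRate m 1 * c)) ^ k / (k ! : ℝ)))
      (W z * Real.exp (t * (dualRate m 1 * c))) := by
    rw [Real.exp_eq_exp_ℝ]
    exact (NormedSpace.expSeries_div_hasSum_exp (t * (dualRate m 1 * c))).mul_left _
  have h1 : ∑' k, t ^ k / (k ! : ℝ) * (dualOp m p N 1)^[k] (fun x => ∏ i, r (x i)) (fun _ => z) ≤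
      W z * Real.exp (t * (dualRate m 1 * c)) := by
    rw [← hexp.tsum_eq]
    refine Summable.tsum_le_tsum (fun k => ?_) ?_ hexp.summable
    · have ht0 := ht.1
      calc _ ≤ t ^ k / (k ! : ℝ) * (W z * (dualRate m 1 * c) ^ k) := by
            refine mul_le_mul_of_nonneg_left ((le_abs_self _).trans ?_) (by positivity)
            simpa using hb k
        _ = _ := by rw [mul_pow]; ring
    · exact summable_expSeries (M := W z) (c := dualRate m 1 * c) (by simpa using hb) t
  have h0 : 0 ≤ ∑' k, t ^ k / (k ! : ℝ) *
      (dualOp m p N 1)^[k] (fun x => ∏ i, r (x i)) (fun _ => z) := by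
    refine tsum_nonneg fun k => mul_nonneg (by have := ht.1; positivity) ?_
    exact (finitePositive_dualOp hm hp).iterate_nonneg
      (fun x => Finset.prod_nonneg fun i _ => hr _) k _
  calc walkMean m p N r t z ≤ 1 * (W z * Real.exp (t * (dualRate m 1 * c))) := by
        refine mul_le_mul ?_ h1 h0 zero_le_one
        rw [Real.exp_le_one_iff, neg_nonpos]
        exact mul_nonneg hd ht.1
    _ ≤ _ := by
        rw [one_mul, mul_comm]
        gcongr
        exact ht.2

/-- The backward equation for a single particle. -/
theorem hasDerivAt_walkMean (hm : 0 < m) (hp : IsWalkKernel p)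
    (hN : ∀ x, ∀ y ∉ N x, p x y = 0) (hr : ∀ x, 0 ≤ r x) (hrW : ∀ x, r x ≤ W x) (hc : 1 ≤ c)
    (hWc : ∀ x y, p x y ≠ 0 → W y ≤ c * W x) (t : ℝ) (z : S) :
    HasDerivAt (fun s => walkMean m p N r s z)
      (∑ y ∈ N z, 2 * m * p z y * (walkMean m p N r t y - walkMean m p N r t z)) t := by
  have hA := finitePositive_dualOp (N := N) (n := 1) hm hp
  have hb := abs_iterate_dualOp_le (n := 1) hm hp hN hr hrW hc hWc
  set a := dualRate m 1
  set A := dualOp m p N 1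
  set σ : ℝ → (Fin 1 → S) → ℝ := fun s x => ∑' k, s ^ k / (k ! : ℝ) *
    A^[k] (fun x => ∏ i, r (x i)) x with hσ
  have h1 : HasDerivAt (fun s => σ s fun _ => z) (A (σ t) fun _ => z) t := by
    have h := hasDerivAt_expSeries (fun k => hb k fun _ => z) t
    convert! h using 1
    simp only [hσ]
    rw [hA.map_tsum fun x => summable_expSeries (fun k => hb k x) t]
    refine tsum_congr fun k => ?_
    rw [hA.map_const_mul, Function.iterate_succ_apply']
  have h2 : HasDerivAt (fun s : ℝ => Real.exp (-(a * s))) (Real.exp (-(a * t)) * -(a * 1)) t :=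
    ((hasDerivAt_id t).const_mul a).neg.exp
  have h3 := dualOp_sub_dualRate (m := m) hp hN (σ t) fun _ : Fin 1 => z
  have hup : ∀ y, Function.update (fun _ : Fin 1 => z) 0 y = fun _ => y := fun y => by
    funext i
    rw [Subsingleton.elim i 0, Function.update_self]
  simp only [Finset.univ_unique, Finset.sum_singleton, Fin.default_eq_zero, hup, hp.diag,
    mul_zero, zero_mul, add_zero] at h3
  convert! h2.mul h1 using 1
  have h4 : ∀ y, walkMean m p N r t y = Real.exp (-(a * t)) * σ t fun _ => y := fun y => rfl
  simp only [h4, ← mul_sub]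
  have h5 : ∑ y ∈ N z, 2 * m * p z y * (Real.exp (-(a * t)) * ((σ t fun _ => y) - σ t fun _ => z)) =
      Real.exp (-(a * t)) * ∑ y ∈ N z, 2 * m * p z y * ((σ t fun _ => y) - σ t fun _ => z) := by
    rw [Finset.mul_sum]
    exact Finset.sum_congr rfl fun y _ => by ring
  rw [h5, ← h3]
  ring

/-- The interaction part of the generator of the inclusion process is nonnegative on symmetric
product functions. -/
theorem sum_interaction_nonneg (hp : IsWalkKernel p) (hr : ∀ x, 0 ≤ r x) (x : Fin n → S) :
    0 ≤ ∑ i, ∑ j, 4 * p (x i) (x j) *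
      (∏ k, r (Function.update x i (x j) k) - ∏ k, r (x k)) := by
  set F : Fin n → Fin n → ℝ := fun i j => 4 * p (x i) (x j) *
      (∏ k, r (Function.update x i (x j) k) - ∏ k, r (x k)) with hF
  have key : ∀ i j, 0 ≤ F i j + F j i := by
    intro i j
    rcases eq_or_ne i j with rfl | hij
    · simp [hF, hp.diag]
    · set M := ∏ k ∈ (Finset.univ.erase i).erase j, r (x k) with hM
      have hM0 : 0 ≤ M := Finset.prod_nonneg fun k _ => hr _
      have h1 : ∏ k ∈ Finset.univ.erase i, r (x k) = M * r (x j) :=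
        (Finset.prod_erase_mul _ _ (by simp [hij.symm])).symm
      have h2 : ∏ k ∈ Finset.univ.erase j, r (x k) = M * r (x i) := by
        rw [hM, Finset.erase_right_comm]
        exact (Finset.prod_erase_mul _ _ (by simp [hij])).symm
      have h3 : ∏ k, r (x k) = M * r (x j) * r (x i) := by
        rw [← h1]
        exact (Finset.prod_erase_mul _ _ (Finset.mem_univ i)).symm
      -- With M the product over the other particles, the two moves replace r(xᵢ) r(xⱼ) by r(xⱼ)²
      -- and by r(xᵢ)²; subtracting the original product twice completes a square.
      have h4 : F i j + F j i = 4 * p (x i) (x j) * M * (r (x i) - r (x j)) ^ 2 := by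
        simp only [hF, prod_update, h1, h2, h3, hp.symm (x j) (x i)]
        ring
      rw [h4]
      have := hp.nonneg (x i) (x j)
      positivity
  have hsum : ∑ i, ∑ j, (F i j + F j i) = 2 * ∑ i, ∑ j, F i j := by
    simp only [Finset.sum_add_distrib]
    rw [Finset.sum_comm (f := fun i j => F j i)]
    ring
  have : 0 ≤ ∑ i, ∑ j, (F i j + F j i) :=
    Finset.sum_nonneg fun i _ => Finset.sum_nonneg fun j _ => key i j
  linarith

/-- Comparison of inclusion particles with independent walkers. -/
theorem prod_walkMean_le (hm : 0 < m) (hp : IsWalkKernel p)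
    (hN : ∀ x, ∀ y ∉ N x, p x y = 0) (hr : ∀ x, 0 ≤ r x) (hrW : ∀ x, r x ≤ W x) (hc : 1 ≤ c)
    (hWc : ∀ x y, p x y ≠ 0 → W y ≤ c * W x) {t : ℝ} (ht : 0 ≤ t) (x : Fin n → S) :
    ∏ i, walkMean m p N r t (x i) ≤ Real.exp (-(dualRate m n * t)) * ∑' k, t ^ k / (k ! : ℝ) *
        (dualOp m p N n)^[k] (fun x => ∏ i, r (x i)) x := by
  have hA := finitePositive_dualOp (N := N) (n := n) hm hp
  set a := dualRate m n with ha
  have ha0 : 0 ≤ a := dualRate_nonneg hm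
  set ρ := walkMean m p N r with hρ
  set g : ℝ → (Fin n → S) → ℝ := fun s x => Real.exp (a * s) * ∏ i, ρ s (x i) with hg
  set g' : ℝ → (Fin n → S) → ℝ := fun s x => Real.exp (a * s) * (a * 1) * ∏ i, ρ s (x i) +
    Real.exp (a * s) * ∑ i, (∏ j ∈ Finset.univ.erase i, ρ s (x j)) •
      ∑ y ∈ N (x i), 2 * m * p (x i) y * (ρ s y - ρ s (x i)) with hg'
  have hder : ∀ s x, HasDerivAt (fun s => g s x) (g' s x) s := by
    intro s x
    have h1 : HasDerivAt (fun s : ℝ => Real.exp (a * s)) (Real.exp (a * s) * (a * 1)) s :=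
      ((hasDerivAt_id s).const_mul a).exp
    exact h1.mul (HasDerivAt.fun_finsetProd fun i _ =>
      hasDerivAt_walkMean hm hp hN hr hrW hc hWc s (x i))
  -- The time derivative of the product matches the free-walk part of the generator exactly (`h4`);
  -- the discarded interaction part is nonnegative.
  have hsub : ∀ s ∈ Set.Icc 0 t, ∀ x, g' s x ≤ dualOp m p N n (g s) x := by
    intro s hs x
    have h1 := dualOp_sub_dualRate (m := m) hp hN (g s) x
    have h2 := mul_nonneg (Real.exp_pos (a * s)).le
      (sum_interaction_nonneg hp (walkMean_nonneg hm hp hr (N := N) hs.1) x)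
    have h3 : ∑ i, ∑ j, 4 * p (x i) (x j) * (g s (Function.update x i (x j)) - g s x) =
        Real.exp (a * s) * ∑ i, ∑ j, 4 * p (x i) (x j) *
          (∏ k, ρ s (Function.update x i (x j) k) - ∏ k, ρ s (x k)) := by
      simp only [Finset.mul_sum, hg]
      exact Finset.sum_congr rfl fun i _ => Finset.sum_congr rfl fun j _ => by ring
    have h4 : ∑ i, ∑ y ∈ N (x i), 2 * m * p (x i) y * (g s (Function.update x i y) - g s x) =
        g' s x - a * g s x := by
      simp only [hg, hg', prod_update]
      rw [mul_one, mul_comm _ a, mul_assoc, add_sub_cancel_left, Finset.mul_sum]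
      refine Finset.sum_congr rfl fun i _ => ?_
      rw [smul_eq_mul, Finset.mul_sum, Finset.mul_sum,
        ← Finset.prod_erase_mul _ (fun j => ρ s (x j)) (Finset.mem_univ i)]
      exact Finset.sum_congr rfl fun y _ => by ring
    rw [h3, h4, ← ha] at h1
    linarith
  have hbound : ∀ s ∈ Set.Icc 0 t, ∀ x, g s x ≤
      (Real.exp (a * t) * Real.exp (t * (dualRate m 1 * c)) ^ n) * ∏ i, W (x i) := by
    intro s hs x
    have h1 : ∏ i, ρ s (x i) ≤ ∏ i, (Real.exp (t * (dualRate m 1 * c)) * W (x i)) :=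
      Finset.prod_le_prod (fun i _ => walkMean_nonneg hm hp hr hs.1 _)
        fun i _ => walkMean_le hm hp hN hr hrW hc hWc hs _
    rw [Finset.prod_mul_distrib, Finset.prod_const, Finset.card_univ, Fintype.card_fin] at h1
    rw [mul_assoc]
    refine mul_le_mul ?_ h1 (Finset.prod_nonneg fun i _ => walkMean_nonneg hm hp hr hs.1 _)
      (Real.exp_pos _).le
    gcongr
    exact hs.2
  have hg0 : g 0 = fun x => ∏ i, r (x i) := by
    funext x
    simp [hg, hρ, walkMean_zero]
  have hfin := hA.le_tsum_of_hasDerivAt (T := t) (by positivity) (by positivity)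
    (dualOp_prod_le hm hp hN (fun x => (hr x).trans (hrW x)) hc hWc) hder hsub hbound
    (fun x => by rw [hg0]; exact Finset.prod_nonneg fun i _ => hr _) ⟨ht, le_rfl⟩ x
  rw [hg0] at hfin
  calc ∏ i, ρ t (x i) = Real.exp (-(a * t)) * g t x := by
        simp only [hg]
        rw [← mul_assoc, ← Real.exp_add, neg_add_cancel, Real.exp_zero, one_mul]
    _ ≤ _ := mul_le_mul_of_nonneg_left hfin (Real.exp_pos _).le

variable {X : Set (S → ℕ)} {P : ℝ≥0 → Kernel (S → ℕ) (S → ℕ)} {lam : S → ℝ}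

theorem prod_dualityMoment_le (hm : 0 < m) (hp : IsWalkKernel p)
    (hN : ∀ x, ∀ y ∉ N x, p x y = 0) (hP : IsSIPSemigroup m p X P)
    (hlam : ∀ x, lam x ∈ Set.Ico (0 : ℝ) 1) (hX : ∀ᵐ η ∂(localStationary m lam), η ∈ X)
    (hrW : ∀ x, lam x / (1 - lam x) ≤ W x) (hc : 1 ≤ c)
    (hWc : ∀ x y, p x y ≠ 0 → W y ≤ c * W x) (t : ℝ≥0) (x : Fin n → S) :
    ∏ i, dualityMoment m ((localStationary m lam).bind (P t)) ![x i] ≤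
      dualityMoment m ((localStationary m lam).bind (P t)) x := by
  have hr : ∀ x, 0 ≤ lam x / (1 - lam x) := fun x =>
    div_nonneg (hlam x).1 (by linarith [(hlam x).2])
  have h1 : ∀ z : S, (![z] : Fin 1 → S) = fun _ => z := fun z => by
    funext i
    simp
  simp only [dualityMoment_bind hm hp hN hP hlam hX hrW hc hWc, h1]
  exact prod_walkMean_le hm hp hN hr hrW hc hWc t.coe_nonneg x

theorem integral_bind {α : Type*} [MeasurableSpace α] {β : Type*} [MeasurableSpace β]
    {μ : Measure α} {κ : Kernel α β} {f : β → ℝ} (hf : Integrable f (μ.bind κ)) :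
    ∫ y, f y ∂(μ.bind κ) = ∫ x, ∫ y, f y ∂(κ x) ∂μ := by
  have h : μ.bind κ = (κ ∘ₖ Kernel.const Unit μ) () := by
    rw [Kernel.comp_apply, Kernel.const_apply]
  rw [h] at hf ⊢
  rw [Kernel.integral_comp hf, Kernel.const_apply]

theorem duality_config_singleton (hm : 0 < m) (x : S) (ζ : S → ℕ) :
    (ζ x : ℝ) = m / 2 * duality m (config ![x]) ζ := by
  classical
  have h0 : ∀ z ∉ ({x} : Finset S), config ![x] z = 0 := by
    intro z hz
    rw [Finset.mem_singleton] at hz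
    simp [config, Ne.symm hz]
  have h1 : config ![x] x = 1 := by simp [config]
  rw [duality_eq_prod hm ζ h0, Finset.prod_singleton, h1]
  have := singleDuality_succ_left hm 0 (ζ x)
  simp only [singleDuality_zero hm] at this
  simpa using this.symm

theorem duality_config_pair_of_ne (hm : 0 < m) {x y : S} (hxy : x ≠ y) (ζ : S → ℕ) :
    (ζ x : ℝ) * ζ y = (m / 2) ^ 2 * duality m (config ![x, y]) ζ := by
  classical
  have h0 : ∀ z ∉ ({x, y} : Finset S), config ![x, y] z = 0 := by
    intro z hz
    simp only [Finset.mem_insert, Finset.mem_singleton, not_or] at hz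
    simp [config, Ne.symm hz.1, Ne.symm hz.2]
  have h1 : config ![x, y] x = 1 := by
    simp [config, Fin.sum_univ_two, hxy.symm, -Finset.sum_boole]
  have h2 : config ![x, y] y = 1 := by
    simp [config, Fin.sum_univ_two, hxy, -Finset.sum_boole]
  rw [duality_eq_prod hm ζ h0, Finset.prod_pair hxy, h1, h2]
  have hx := singleDuality_succ_left hm 0 (ζ x)
  have hy := singleDuality_succ_left hm 0 (ζ y)
  simp only [singleDuality_zero hm] at hx hy
  simp only [Nat.cast_zero, add_zero, sub_zero, mul_one, zero_add] at hx hy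
  rw [← hx, ← hy]
  ring

/-- Two dual particles on one site measure the factorial moment, and ζ² = ζ(ζ - 1) + ζ. -/
theorem duality_config_pair_self (hm : 0 < m) (x : S) (ζ : S → ℕ) :
    (ζ x : ℝ) * ζ x = m / 2 * (m / 2 + 1) * duality m (config ![x, x]) ζ +
      m / 2 * duality m (config ![x]) ζ := by
  classical
  have h0 : ∀ z ∉ ({x} : Finset S), config ![x, x] z = 0 := by
    intro z hz
    rw [Finset.mem_singleton] at hz
    simp [config, Ne.symm hz]
  have h1 : config ![x, x] x = 2 := by
    simp [config, Fin.sum_univ_two, -Finset.sum_boole]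
  rw [← duality_config_singleton hm, duality_eq_prod hm ζ h0, Finset.prod_singleton, h1]
  have hx := singleDuality_succ_left hm 0 (ζ x)
  have hy := singleDuality_succ_left hm 1 (ζ x)
  simp only [singleDuality_zero hm] at hx hy
  simp only [Nat.cast_zero, Nat.cast_one, add_zero, sub_zero, mul_one, zero_add,
    Nat.reduceAdd] at hx hy
  linear_combination -(m / 2) * hy - ((ζ x : ℝ) - 1) * hx

/-- Correlation inequality for the inclusion process started from a product of discrete gamma
distributions whose profile is dominated by a function `W` that varies boundedly along `p`. -/
theorem correlation_inequality (hm : 0 < m) (hp : IsWalkKernel p)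
    (hN : ∀ x, ∀ y ∉ N x, p x y = 0) (hP : IsSIPSemigroup m p X P)
    (hlam : ∀ x, lam x ∈ Set.Ico (0 : ℝ) 1) (hX : ∀ᵐ η ∂(localStationary m lam), η ∈ X)
    (hrW : ∀ x, lam x / (1 - lam x) ≤ W x) (hc : 1 ≤ c)
    (hWc : ∀ x y, p x y ≠ 0 → W y ≤ c * W x) (t : ℝ≥0) :
    (∀ (n : ℕ) (x : Fin n → S),
      Integrable (duality m (config x)) ((localStationary m lam).bind (P t)) ∧
      ∏ i, dualityMoment m ((localStationary m lam).bind (P t)) ![x i] ≤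
        dualityMoment m ((localStationary m lam).bind (P t)) x) ∧
    (∀ x y : S,
      Integrable (fun ζ : S → ℕ => (ζ x : ℝ)) ((localStationary m lam).bind (P t)) ∧
      Integrable (fun ζ : S → ℕ => (ζ x : ℝ) * (ζ y : ℝ)) ((localStationary m lam).bind (P t)) ∧
      (∫ η, ∫ ζ, (ζ x : ℝ) ∂(P t η) ∂(localStationary m lam)) *
          (∫ η, ∫ ζ, (ζ y : ℝ) ∂(P t η) ∂(localStationary m lam)) ≤
        ∫ η, ∫ ζ, (ζ x : ℝ) * (ζ y : ℝ) ∂(P t η) ∂(localStationary m lam)) := by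
  have hInt : ∀ (n : ℕ) (x : Fin n → S),
      Integrable (duality m (config x)) ((localStationary m lam).bind (P t)) :=
    fun n x => integrable_duality_bind hm hp hN hP hlam hX hrW hc hWc t x
  refine ⟨fun n x => ⟨hInt n x, prod_dualityMoment_le hm hp hN hP hlam hX hrW hc hWc t x⟩,
    fun x y => ?_⟩
  have hone : ∀ x : S,
      Integrable (fun ζ : S → ℕ => (ζ x : ℝ)) ((localStationary m lam).bind (P t)) := by
    intro x
    simp only [duality_config_singleton hm x]
    exact (hInt 1 ![x]).const_mul _
  have htwo : Integrable (fun ζ : S → ℕ => (ζ x : ℝ) * (ζ y : ℝ))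
      ((localStationary m lam).bind (P t)) := by
    rcases eq_or_ne x y with rfl | hxy
    · simp only [duality_config_pair_self hm x]
      exact ((hInt 2 ![x, x]).const_mul _).add ((hInt 1 ![x]).const_mul _)
    · simp only [duality_config_pair_of_ne hm hxy]
      exact (hInt 2 ![x, y]).const_mul _
  refine ⟨hone x, htwo, ?_⟩
  rw [← integral_bind (hone x), ← integral_bind (hone y), ← integral_bind htwo]
  have hmom : ∀ x : S, ∫ ζ, (ζ x : ℝ) ∂((localStationary m lam).bind (P t)) =
      m / 2 * dualityMoment m ((localStationary m lam).bind (P t)) ![x] := by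
    intro x
    simp only [duality_config_singleton hm x]
    exact integral_const_mul _ _
  have hle := prod_dualityMoment_le hm hp hN hP hlam hX hrW hc hWc t ![x, y]
  simp only [Fin.prod_univ_two, Matrix.cons_val_zero, Matrix.cons_val_one] at hle
  rw [hmom x, hmom y]
  -- On the diagonal the second moment exceeds the duality moment by nonnegative terms, so the
  -- inequality persists for x = y.
  have hpair : (m / 2) ^ 2 * dualityMoment m ((localStationary m lam).bind (P t)) ![x, y] ≤
      ∫ ζ, (ζ x : ℝ) * (ζ y : ℝ) ∂((localStationary m lam).bind (P t)) := by
    rcases eq_or_ne x y with rfl | hxy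
    · simp only [duality_config_pair_self hm x]
      rw [integral_add ((hInt 2 ![x, x]).const_mul _) ((hInt 1 ![x]).const_mul _),
        integral_const_mul, integral_const_mul]
      have h2 : 0 ≤ ∫ ζ, duality m (config ![x, x]) ζ ∂((localStationary m lam).bind (P t)) :=
        integral_nonneg fun ζ => duality_nonneg hm _ _
      have h1 : 0 ≤ ∫ ζ, duality m (config ![x]) ζ ∂((localStationary m lam).bind (P t)) :=
        integral_nonneg fun ζ => duality_nonneg hm _ _
      rw [dualityMoment]
      have h3 := mul_nonneg hm.le h1
      have h4 := mul_nonneg hm.le h2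
      linarith
    · simp only [duality_config_pair_of_ne hm hxy]
      rw [integral_const_mul]
      exact le_rfl
  have := mul_le_mul_of_nonneg_left hle (by positivity : 0 ≤ (m / 2) ^ 2)
  linarith

end Comparison

/-! ### Polynomial growth of profiles on the lattice. -/

noncomputable section Tempered

variable {m l : ℝ}

theorem natCast_eq_singleDuality (hm : 0 < m) (n : ℕ) :
    (n : ℝ) = m / 2 * singleDuality m 1 n := by
  have := singleDuality_succ_left hm 0 n
  simp only [singleDuality_zero hm] at this
  simpa using this.symm

theorem natCast_sq_eq_singleDuality (hm : 0 < m) (n : ℕ) :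
    (n : ℝ) ^ 2 = m / 2 * (m / 2 + 1) * singleDuality m 2 n + m / 2 * singleDuality m 1 n := by
  have h1 := natCast_eq_singleDuality hm n
  have h2 := singleDuality_succ_left hm 1 n
  simp only [Nat.cast_one, Nat.reduceAdd] at h2
  linear_combination ((n : ℝ) - 1 + 1) * h1 - m / 2 * h2

/-- A discrete gamma variable is at least of the order of its mean with a probability that is
bounded below, when the mean is not small. -/
theorem le_measureReal_discreteGamma (hm : 0 < m) (hl : l ∈ Set.Ico (0 : ℝ) 1)
    (h1 : 1 ≤ l / (1 - l)) :
    m / 2 / (4 * (m / 2 + 2)) ≤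
      (discreteGamma m l).real {n | m / 2 / 2 * (l / (1 - l)) ≤ n} := by
  have := isProbabilityMeasure_discreteGamma hm hl
  set κ := m / 2 with hκ
  have hκ0 : 0 < κ := by positivity
  set ρ := l / (1 - l) with hρ
  have hρ0 : 0 < ρ := by linarith
  set A : Set ℕ := {n | κ / 2 * ρ ≤ n}
  -- Off A the first term suffices; on A it is n ≤ n²/(4b) + b with b = (κ + 2) ρ. The mean is κρ
  -- and the second moment at most κ(κ + 2)ρ² when ρ ≥ 1, so the first two terms account for at most
  -- 3/4 of the mean and the rest must come from A.
  have hpt : ∀ n : ℕ, κ * singleDuality m 1 n ≤ κ / 2 * ρ +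
      (1 / (4 * (κ + 2) * ρ)) * (κ * (κ + 1) * singleDuality m 2 n + κ * singleDuality m 1 n) +
        ((κ + 2) * ρ) * A.indicator 1 n := by
    intro n
    rw [← natCast_sq_eq_singleDuality hm, ← natCast_eq_singleDuality hm]
    by_cases hn : n ∈ A
    · rw [Set.indicator_of_mem hn, Pi.one_apply, mul_one]
      have h2 : (n : ℝ) ≤ 1 / (4 * (κ + 2) * ρ) * (n : ℝ) ^ 2 + (κ + 2) * ρ := by
        have h3 : 1 / (4 * (κ + 2) * ρ) * (n : ℝ) ^ 2 + (κ + 2) * ρ - n =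
            (n - 2 * ((κ + 2) * ρ)) ^ 2 / (4 * (κ + 2) * ρ) := by
          field_simp
          ring
        have h4 : 0 ≤ ((n : ℝ) - 2 * ((κ + 2) * ρ)) ^ 2 / (4 * (κ + 2) * ρ) := by positivity
        linarith
      have h5 : 0 ≤ κ / 2 * ρ := by positivity
      linarith
    · rw [Set.indicator_of_notMem hn, mul_zero, add_zero]
      have h2 : (n : ℝ) ≤ κ / 2 * ρ := by
        have : ¬ (κ / 2 * ρ ≤ (n : ℝ)) := hn
        exact (not_le.1 this).le
      have h3 : 0 ≤ 1 / (4 * (κ + 2) * ρ) * (n : ℝ) ^ 2 := by positivity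
      linarith
  have i1 := integrable_singleDuality hm hl 1
  have i2 := integrable_singleDuality hm hl 2
  have iA : Integrable (A.indicator (1 : ℕ → ℝ)) (discreteGamma m l) :=
    (integrable_const (1 : ℝ)).indicator MeasurableSet.of_discrete
  have i3 : Integrable (fun n => κ * (κ + 1) * singleDuality m 2 n + κ * singleDuality m 1 n)
      (discreteGamma m l) := (i2.const_mul _).add (i1.const_mul _)
  have i4 : Integrable (fun n => κ / 2 * ρ + (1 / (4 * (κ + 2) * ρ)) *
      (κ * (κ + 1) * singleDuality m 2 n + κ * singleDuality m 1 n)) (discreteGamma m l) :=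
    (integrable_const _).add (i3.const_mul _)
  have hI := integral_mono (i1.const_mul κ) (i4.add (iA.const_mul ((κ + 2) * ρ))) hpt
  simp only [Pi.add_apply] at hI
  rw [integral_add i4 (iA.const_mul _), integral_add (integrable_const _) (i3.const_mul _),
    integral_const, probReal_univ, one_smul] at hI
  simp only [integral_const_mul] at hI
  rw [integral_add (i2.const_mul _) (i1.const_mul _)] at hI
  simp only [integral_const_mul, integral_singleDuality hm hl,
    integral_indicator_one MeasurableSet.of_discrete, ← hρ, pow_one] at hI
  have h2 : 1 / (4 * (κ + 2) * ρ) * (κ * (κ + 1) * ρ ^ 2 + κ * ρ) ≤ κ / 4 * ρ := by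
    rw [one_div_mul_eq_div, div_le_iff₀ (by positivity)]
    nlinarith [mul_pos hκ0 hρ0, mul_nonneg (mul_pos hκ0 hρ0).le (sub_nonneg.2 h1)]
  have h3 : κ / 4 * ρ ≤ (κ + 2) * (discreteGamma m l).real A * ρ := by nlinarith
  have h4 := le_of_mul_le_mul_right h3 hρ0
  rw [div_le_iff₀ (by positivity)]
  linarith

/-- If almost every configuration is tempered then the profile grows at most polynomially. -/
theorem exists_profile_le_of_ae_tempered {d : ℕ} (hm : 0 < m) {lam : (Fin d → ℤ) → ℝ}
    (hlam : ∀ x, lam x ∈ Set.Ico (0 : ℝ) 1)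
    (ht : ∀ᵐ η ∂(localStationary m lam), η ∈ tempered d) :
    ∃ k : ℕ, ∀ y, lam y / (1 - lam y) ≤ k * (1 + ‖y‖) ^ k := by
  have hprob := fun x => isProbabilityMeasure_discreteGamma hm (hlam x)
  -- Failure for every k gives sites y k at which the profile exceeds k (1 + ‖y k‖)^k.
  by_contra! hcon
  choose y hy using hcon
  set μ := localStationary m lam with hμ
  have : IsProbabilityMeasure μ := by rw [hμ, localStationary]; infer_instance
  set ρ : ℕ → ℝ := fun k => lam (y k) / (1 - lam (y k)) with hρ
  set ε := m / 2 / 2 with hε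
  have hε0 : 0 < ε := by positivity
  set δ := m / 2 / (4 * (m / 2 + 2)) with hδ
  have hδ0 : 0 < δ := by positivity
  set A : ℕ → Set ((Fin d → ℤ) → ℕ) := fun k => {η | ε * ρ k ≤ η (y k)} with hA
  have hAm : ∀ k, MeasurableSet (A k) := fun k =>
    measurableSet_le measurable_const (measurable_from_nat.comp (measurable_pi_apply (y k)))
  have hAδ : ∀ k, 1 ≤ k → ENNReal.ofReal δ ≤ μ (A k) := by
    intro k hk
    have h1 : 1 ≤ ρ k := by
      have h2 : (1 : ℝ) ≤ k := by exact_mod_cast hk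
      have h3 : (1 : ℝ) ≤ (1 + ‖y k‖) ^ k := one_le_pow₀ (by linarith [norm_nonneg (y k)])
      have h4 := hy k
      simp only [hρ]
      nlinarith
    have h2 := le_measureReal_discreteGamma hm (hlam (y k)) h1
    have h3 : μ (A k) = discreteGamma m (lam (y k)) {n | ε * ρ k ≤ n} :=
      (measurePreserving_eval_infinitePi (fun x => discreteGamma m (lam x)) (y k)).measure_preimage
        (s := {n : ℕ | ε * ρ k ≤ n}) MeasurableSet.of_discrete.nullMeasurableSet
    rw [h3]
    exact (ENNReal.ofReal_le_iff_le_toReal (measure_ne_top _ _)).2 h2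
  -- The intersection of the B j is the event that infinitely many A k occur. It has measure at
  -- least δ by continuity from above, without independence or distinctness of the sites.
  set B : ℕ → Set ((Fin d → ℤ) → ℕ) := fun j => ⋃ k ≥ j, A k with hB
  have hBm : ∀ j, MeasurableSet (B j) := fun j =>
    MeasurableSet.iUnion fun k => MeasurableSet.iUnion fun _ => hAm k
  have hBanti : Antitone B := fun i j hij =>
    Set.iUnion_mono fun k => Set.iUnion_mono' fun hk => ⟨hij.trans hk, subset_rfl⟩
  have hlim := tendsto_measure_iInter_atTop (μ := μ) (fun j => (hBm j).nullMeasurableSet) hBanti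
    ⟨0, measure_ne_top _ _⟩
  have hge : ENNReal.ofReal δ ≤ μ (⋂ j, B j) := by
    refine ge_of_tendsto' hlim fun j => (hAδ (j + 1) (by omega)).trans (measure_mono ?_)
    exact Set.subset_iUnion₂_of_subset (j + 1) (Nat.le_succ j) subset_rfl
  have hsub : (⋂ j, B j) ⊆ (tempered d)ᶜ := by
    rintro η hη ⟨C, k₀, hC⟩
    -- Beyond max j k₀ both the constant C and the exponent k₀ are beaten by those of the profile.
    obtain ⟨j, hj⟩ := exists_nat_gt (C / ε)
    have hmem := Set.mem_iInter.1 hη (max j k₀)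
    simp only [hB, Set.mem_iUnion] at hmem
    obtain ⟨k, hk, hAk⟩ := hmem
    have hk1 : j ≤ k := (le_max_left _ _).trans hk
    have hk2 : k₀ ≤ k := (le_max_right _ _).trans hk
    have h1 : ε * ρ k ≤ (η (y k) : ℝ) := hAk
    have h2 := hC (y k)
    have hb : (1 : ℝ) ≤ 1 + ‖y k‖ := by linarith [norm_nonneg (y k)]
    have h3 : (1 + ‖y k‖) ^ k₀ ≤ (1 + ‖y k‖) ^ k := pow_le_pow_right₀ hb hk2
    have h4 : C < ε * k := by
      rw [div_lt_iff₀ hε0] at hj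
      have : (j : ℝ) ≤ k := by exact_mod_cast hk1
      nlinarith
    have h5 : ε * (k * (1 + ‖y k‖) ^ k) < ε * ρ k := mul_lt_mul_of_pos_left (hy k) hε0
    have h6 : C * (1 + ‖y k‖) ^ k₀ ≤ ε * k * (1 + ‖y k‖) ^ k :=
      mul_le_mul h4.le h3 (by positivity) (by positivity)
    linarith
  have hzero : μ (⋂ j, B j) = 0 := measure_mono_null hsub ht
  rw [hzero, nonpos_iff_eq_zero, ENNReal.ofReal_eq_zero] at hge
  linarith

theorem HasFiniteRange.exists_neighbours {d : ℕ} {p : (Fin d → ℤ) → (Fin d → ℤ) → ℝ}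
    (h : HasFiniteRange p) :
    ∃ N : (Fin d → ℤ) → Finset (Fin d → ℤ), ∀ x, ∀ y ∉ N x, p x y = 0 := by
  obtain ⟨R, -, hR⟩ := h
  have hfin : ∀ x : Fin d → ℤ, (Metric.closedBall x R).Finite := fun x =>
    (isCompact_closedBall x R).finite ⟨inferInstance⟩
  refine ⟨fun x => (hfin x).toFinset, fun x y hy => hR x y ?_⟩
  rw [Set.Finite.mem_toFinset, Metric.mem_closedBall, not_le, dist_comm, dist_eq_norm] at hy
  exact hy

end Tempered

end SIP

theorem proposition5p1 :
    -- the case of a finite set `S`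
    (∀ (S : Type*) [Finite S] (m : ℝ) (_ : 0 < m)
      (p : S → S → ℝ) (_ : SIP.IsWalkKernel p)
      (P : ℝ≥0 → Kernel (S → ℕ) (S → ℕ)) (_ : SIP.IsSIPSemigroup m p Set.univ P)
      (lam : S → ℝ) (_ : ∀ x, lam x ∈ Set.Ico (0 : ℝ) 1) (t : ℝ≥0),
      (∀ (n : ℕ) (x : Fin n → S),
        Integrable (SIP.duality m (SIP.config x)) ((SIP.localStationary m lam).bind (P t)) ∧
        ∏ i, SIP.dualityMoment m ((SIP.localStationary m lam).bind (P t)) ![x i] ≤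
          SIP.dualityMoment m ((SIP.localStationary m lam).bind (P t)) x) ∧
      (∀ x y : S,
        Integrable (fun ζ : S → ℕ => (ζ x : ℝ)) ((SIP.localStationary m lam).bind (P t)) ∧
        Integrable (fun ζ : S → ℕ => (ζ x : ℝ) * (ζ y : ℝ))
          ((SIP.localStationary m lam).bind (P t)) ∧
        (∫ η, ∫ ζ, (ζ x : ℝ) ∂(P t η) ∂(SIP.localStationary m lam)) *
            (∫ η, ∫ ζ, (ζ y : ℝ) ∂(P t η) ∂(SIP.localStationary m lam)) ≤
          ∫ η, ∫ ζ, (ζ x : ℝ) * (ζ y : ℝ) ∂(P t η) ∂(SIP.localStationary m lam))) ∧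
    -- the case of the lattice `ℤ^d`
    (∀ (d : ℕ) (m : ℝ) (_ : 0 < m)
      (p : (Fin d → ℤ) → (Fin d → ℤ) → ℝ) (_ : SIP.IsWalkKernel p)
      (_ : SIP.IsTranslationInvariant p) (_ : SIP.HasFiniteRange p)
      (P : ℝ≥0 → Kernel ((Fin d → ℤ) → ℕ) ((Fin d → ℤ) → ℕ))
      (_ : SIP.IsSIPSemigroup m p (SIP.tempered d) P)
      (lam : (Fin d → ℤ) → ℝ) (_ : ∀ x, lam x ∈ Set.Ico (0 : ℝ) 1)
      (_ : ∀ᵐ η ∂(SIP.localStationary m lam), η ∈ SIP.tempered d) (t : ℝ≥0),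
      (∀ (n : ℕ) (x : Fin n → (Fin d → ℤ)),
        Integrable (SIP.duality m (SIP.config x)) ((SIP.localStationary m lam).bind (P t)) ∧
        ∏ i, SIP.dualityMoment m ((SIP.localStationary m lam).bind (P t)) ![x i] ≤
          SIP.dualityMoment m ((SIP.localStationary m lam).bind (P t)) x) ∧
      (∀ x y : Fin d → ℤ,
        Integrable (fun ζ : (Fin d → ℤ) → ℕ => (ζ x : ℝ))
          ((SIP.localStationary m lam).bind (P t)) ∧
        Integrable (fun ζ : (Fin d → ℤ) → ℕ => (ζ x : ℝ) * (ζ y : ℝ))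
          ((SIP.localStationary m lam).bind (P t)) ∧
        (∫ η, ∫ ζ, (ζ x : ℝ) ∂(P t η) ∂(SIP.localStationary m lam)) *
            (∫ η, ∫ ζ, (ζ y : ℝ) ∂(P t η) ∂(SIP.localStationary m lam)) ≤
          ∫ η, ∫ ζ, (ζ x : ℝ) * (ζ y : ℝ) ∂(P t η) ∂(SIP.localStationary m lam))) := by
  refine ⟨?_, ?_⟩
  · intro S _ m hm p hp P hP lam hlam t
    have := Fintype.ofFinite S
    have hr : ∀ x, 0 ≤ lam x / (1 - lam x) := fun x =>
      div_nonneg (hlam x).1 (by linarith [(hlam x).2])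
    -- On a finite set a constant weight dominates the profile and has ratio c = 1.
    exact SIP.correlation_inequality (N := fun _ => Finset.univ)
      (W := fun _ => ∑ x, lam x / (1 - lam x)) (c := 1) hm hp
      (fun x y hy => absurd (Finset.mem_univ y) hy) hP hlam (ae_of_all _ fun _ => Set.mem_univ _)
      (fun x => Finset.single_le_sum (f := fun x => lam x / (1 - lam x)) (fun x _ => hr x)
        (Finset.mem_univ x)) le_rfl (fun _ _ _ => (one_mul _).ge) t
  · intro d m hm p hp _ hR P hP lam hlam hX t
    obtain ⟨N, hN⟩ := hR.exists_neighbours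
    obtain ⟨k, hk⟩ := SIP.exists_profile_le_of_ae_tempered hm hlam hX
    obtain ⟨R, hR0, hR⟩ := hR
    -- A jump has length at most R, so 1 + ‖y‖ changes by a factor at most 1 + R, and its k-th power
    -- by at most c.
    refine SIP.correlation_inequality (W := fun y => k * (1 + ‖y‖) ^ k) (c := (1 + R) ^ k) hm hp
      hN hP hlam hX hk (one_le_pow₀ (by linarith)) (fun x y hxy => ?_) t
    have h1 : ‖x - y‖ ≤ R := not_lt.1 fun h => hxy (hR x y h)
    have h2 : ‖y‖ ≤ ‖x‖ + ‖x - y‖ := by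
      have := norm_sub_le x (x - y)
      rwa [sub_sub_cancel] at this
    have h3 : 1 + ‖y‖ ≤ (1 + R) * (1 + ‖x‖) := by
      nlinarith [mul_nonneg hR0.le (norm_nonneg x)]
    calc (k : ℝ) * (1 + ‖y‖) ^ k ≤ k * ((1 + R) * (1 + ‖x‖)) ^ k := by gcongr
      _ = (1 + R) ^ k * (k * (1 + ‖x‖) ^ k) := by rw [mul_pow]; ring
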